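/- Let $L$ be an alternating knot and let $D$ be a reduced alternating diagram of $L$ on the sphere ("reduced": no crossing is nugatory, i.e. the four corners at a crossing never have two opposite ones in the same complementary region; the crossingless circle is allowed as a diagram of the unknot). Let $$\langle D\rangle=\sum_{s}A^{\sigma(s)}\,(-A^{2}-A^{-2})^{|s|}=\sum_j a_jA^j$$ be the Kauffman bracket of $D$, where $s$ runs over the Kauffman states of $D$, $\sigma(s)$ is the number of positive minus the number of negative smoothings and $|s|$ is the number of circles of $s$ (so a crossingless circle has bracket $-A^2-A^{-2}$). Let $k$ and $l$ be the largest and the smallest exponent with non-zero coefficient. Call two crossings of $D$ twist-equivalent if they share two opposite complementary regions (that is, a simple closed curve on the sphere meets $D$ exactly in these two crossings, passing at each from a corner to the opposite corner), and let the twist number $T(D)$ be the number of classes of the equivalence relation generated in this way. Then $$|a_{k-4}-a_k|+|a_{l+4}-a_l|=T(D).$$ Equivalently, let $V_L(t)\in\mathbb Z[t,t^{-1}]$ be the Jones polynomial of $L$, determined by $(-A^2-A^{-2})\,V_L(A^{-4})=(-A^3)^{-w}\langle D\rangle$ with $w$ the writhe of $D$, and write $V_L(t)=\sum_{i=p}^{q}v_it^i$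 with $v_p\neq0\neq v_q$; then $V_L$ exists and $$|v_{p+1}|+|v_{q-1}|=T(D)$$ (with $v_i=0$ for $i$ outside $[p,q]$). Moreover, if $D$ is twist-reduced, i.e. any two twist-equivalent crossings are connected by a chain of bigons, then $T(D)$ is the number of equivalence classes of crossings under the equivalence relation generated by "there is a bigon connecting the two crossings". -/

import Mathlib

/-- The half-edges ("darts") at `n` crossings.  The half-edges at a crossing `c` are
`(c, 0), (c, 1), (c, 2), (c, 3)` in counterclockwise order; `(c, 0)` and `(c, 2)` form the strand
that passes under, `(c, 1)` and `(c, 3)` the strand that passes over.  The dart `(c, i)` also names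
the corner at `c` between the half-edges `i` and `i + 1`. -/
abbrev Dart (n : ℕ) : Type := Fin n × ZMod 4

/-- The half-edge (or corner) reached from `d` by `k` counterclockwise quarter turns around its
crossing. -/
def Dart.turn {n : ℕ} (k : ZMod 4) (d : Dart n) : Dart n := (d.1, d.2 + k)

/-- The half-edge `d` belongs to the strand that passes over. -/
def Dart.IsOver {n : ℕ} (d : Dart n) : Prop := d.2 = 1 ∨ d.2 = 3

instance {n : ℕ} (d : Dart n) : Decidable d.IsOver :=
  inferInstanceAs (Decidable (d.2 = 1 ∨ d.2 = 3))

/-- A connected (unoriented) link diagram on the sphere, given by its crossings and by the way in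
which their half-edges are glued in pairs to form the edges of the diagram.

The faces of the resulting 4-valent map are the orbits of `d ↦ (glue d).turn (-1)` on corners: from
the corner `d` one walks along the half-edge `d`, keeping the face on the left, and arrives
at the next corner of this face.  As there are `n` vertices and `2 n` edges, the map lies on the
sphere iff the number of faces is `n + 2`.

For `n = 0` the (unique) diagram stands for the crossingless circle. -/
structure LinkDiagram where
  /-- The number of crossings. -/
  n : ℕ
  /-- The other half of the edge to which a half-edge belongs. -/
  glue : Dart n → Dart n
  glue_glue : ∀ d, glue (glue d) = d
  glue_ne : ∀ d, glue d ≠ d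
  connected : ∀ d d' : Dart n,
    Relation.EqvGen (fun x y => y = glue x ∨ y = x.turn 1) d d'
  planar : 0 < n → Nat.card (Quot (fun x y : Dart n => y = (glue x).turn (-1))) = n + 2

namespace LinkDiagram

variable (D : LinkDiagram)

/-- The corner that follows the corner `d` on the boundary of its face. -/
def nextCorner (d : Dart D.n) : Dart D.n := (D.glue d).turn (-1)

/-- The faces (complementary regions) of a diagram with at least one crossing. -/
def Face : Type := Quot (fun x y : Dart D.n => y = D.nextCorner x)

/-- The face in which a corner lies. -/
def face (d : Dart D.n) : D.Face := Quot.mk _ d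

/-- The diagram has one component: any two half-edges are connected by following the edges and
going straight ahead at the crossings. -/
def IsKnot : Prop :=
  ∀ d d' : Dart D.n, Relation.EqvGen (fun x y => y = D.glue x ∨ y = x.turn 2) d d'

/-- Over- and undercrossings alternate along the strands: each edge joins an over half-edge to an
under half-edge. -/
def IsAlternating : Prop := ∀ d : Dart D.n, (D.glue d).IsOver ↔ ¬ d.IsOver

/-- No crossing is nugatory: opposite corners of a crossing lie in different faces. -/
def IsReduced : Prop := ∀ d : Dart D.n, D.face d ≠ D.face (d.turn 2)

/-! ### The Kauffman bracket -/

/-- A state chooses for each crossing a positive (`true`) or a negative (`false`) smoothing. -/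
abbrev State : Type := Fin D.n → Bool

variable {D} in
/-- The half-edge to which `d` is connected inside the smoothed crossing.  The positive smoothing
merges the two corners that are swept out when the overstrand is turned counterclockwise (corners
`1` and `3`), so it connects the half-edges `0, 1` and `2, 3`; the negative smoothing connects
`1, 2` and `3, 0`. -/
def State.join (s : D.State) (d : Dart D.n) : Dart D.n :=
  if s d.1 = true then
    if d.IsOver then d.turn (-1) else d.turn 1
  else
    if d.IsOver then d.turn 1 else d.turn (-1)

variable {D} in
/-- The number of circles of a state. -/
noncomputable def State.circles (s : D.State) : ℕ :=
  if D.n = 0 then 1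
  else Nat.card (Quot (fun x y : Dart D.n => y = D.glue x ∨ y = s.join x))

variable {D} in
/-- The number of positive smoothings minus the number of negative smoothings. -/
def State.sigma (s : D.State) : ℤ := ∑ c, if s c = true then 1 else -1

/-- The value `-A ^ 2 - A ^ (-2)` of a circle, where `A` is the variable. -/
noncomputable def circleValue : LaurentPolynomial ℤ :=
  -LaurentPolynomial.T 2 - LaurentPolynomial.T (-2)

/-- The Kauffman bracket `⟨D⟩ = ∑ₛ A ^ σ(s) (-A ^ 2 - A ^ (-2)) ^ |s|`, in which a
crossingless circle has the value `-A ^ 2 - A ^ (-2)`. -/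
noncomputable def kauffmanBracket : LaurentPolynomial ℤ :=
  ∑ s : D.State, LaurentPolynomial.T s.sigma * circleValue ^ s.circles

/-! ### The Jones polynomial -/

/-- An orientation of the link: it says which half-edges point away from their crossing. -/
structure Orientation where
  out : Dart D.n → Bool
  out_glue : ∀ d, out (D.glue d) = !out d
  out_turn : ∀ d, out (d.turn 2) = !out d

variable {D} in
/-- The sign of a crossing: `1` if a counterclockwise quarter turn takes the direction of the
overstrand to that of the understrand, `-1` otherwise. -/
def Orientation.sign (o : D.Orientation) (c : Fin D.n) : ℤ :=
  if o.out (c, 1) = o.out (c, 2) then 1 else -1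

variable {D} in
/-- The writhe. -/
def Orientation.writhe (o : D.Orientation) : ℤ := ∑ c, o.sign c

variable {D} in
/-- `V` is the Jones polynomial of the oriented link:
`(-A ^ 2 - A ^ (-2)) V(A ^ (-4)) = (-A ^ 3) ^ (-w) ⟨D⟩`, where `w` is the writhe.
This determines `V` uniquely, and `V = 1` for the crossingless circle. -/
def IsJonesPolynomial (o : D.Orientation) (V : LaurentPolynomial ℤ) : Prop :=
  circleValue * AddMonoidAlgebra.mapDomain (fun m : ℤ => -4 * m) V =
    LaurentPolynomial.C (((-1 : ℤˣ) ^ o.writhe : ℤˣ) : ℤ) * LaurentPolynomial.T (-3 * o.writhe) *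
      D.kauffmanBracket

/-! ### The twist number -/

/-- Two crossings share two opposite faces: some closed curve meets the diagram exactly in
these two crossings and passes at each of them from one corner to the opposite one. -/
def TwistRelated (c c' : Fin D.n) : Prop :=
  ∃ i j : ZMod 4, D.face (c, i) = D.face (c', j) ∧ D.face (c, i + 2) = D.face (c', j + 2)

/-- The twist number: the number of classes of the equivalence relation generated by
`TwistRelated`. -/
noncomputable def twistNumber : ℕ := Nat.card (Quot D.TwistRelated)

/-- Two crossings are connected by a bigon, that is, a face with exactly two corners. -/
def BigonRelated (c c' : Fin D.n) : Prop :=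
  ∃ d : Dart D.n, D.nextCorner d ≠ d ∧ D.nextCorner (D.nextCorner d) = d ∧
    d.1 = c ∧ (D.nextCorner d).1 = c'

/-- The number of classes of the equivalence relation generated by `BigonRelated`. -/
noncomputable def bigonTwistNumber : ℕ := Nat.card (Quot D.BigonRelated)

/-- The diagram is twist-reduced: two crossings that share two opposite faces are always connected
by a chain of bigons. -/
def IsTwistReduced : Prop :=
  ∀ c c' : Fin D.n, D.TwistRelated c c' → Relation.EqvGen D.BigonRelated c c'

end LinkDiagram

/-! Let `s` be an extreme state, with the same smoothing at all crossings. Its state graph has the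
circles of `s` as vertices and the crossings as edges. Alternation makes the circles of the two
extreme states the boundaries of the faces of the two checkerboard colours. So for `n > 0` the two
graphs have `n + 2` vertices together, and reducedness says that neither has a loop
(`isAdequate_constState`).

For a set `S` of crossings let `k(S)` be the number of components of the spanning subgraph with edge
set `S`, and `s_S` the state changed on `S`. Euler's formula (`euler`) reads `|s| + |s_S| = 2 k(S) +
|S|`. Hence a nonempty `S` contributes nothing beyond the exponent four steps inside the extreme
one, and contributes there only if its edges are pairwise parallel. The alternating sum over the
nonempty subsets of a parallel class is `-1`, so with `p` parallel classes the two coefficients are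
`±1` and, with the same sign, `±(|s| - p)`. They differ by `p + 1 - |s|` in absolute value, and the
two ends add up to `p₊ + p₋ - n`.

Twist-related means parallel in one of the two graphs (`twistRelated_iff`). In a knot diagram no
crossing has partners in both (`eq_or_eq_of_par`), since such a pair would be a cut of both graphs
and would split the knot into several components. So the join of the two parallelisms has `p₊ + p₋ -
n` classes as well.

For the Jones polynomial, a sign computation at the Seifert state shows that the normalized
exponents are divisible by four. Multiplication by the circle value turns the second outermost
coefficients of `V` into the differences of bracket coefficients. -/

open Relation

/-! ### Class counts of equivalence relations -/

namespace Setoid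

variable {α : Type*}

/-- The number of classes of an equivalence relation. -/
noncomputable def numClasses (r : Setoid α) : ℕ := Nat.card (Quotient r)

/-- The equivalence relation that identifies `a` and `b` only. -/
def pair (a b : α) : Setoid α := EqvGen.setoid fun x y => x = a ∧ y = b

theorem pair_rel (a b : α) : pair a b a b := EqvGen.rel _ _ ⟨rfl, rfl⟩

theorem pair_le_iff {a b : α} {r : Setoid α} : pair a b ≤ r ↔ r a b := by
  refine ⟨fun h => h (pair_rel a b), fun h => Setoid.eqvGen_le ?_⟩
  rintro x y ⟨rfl, rfl⟩
  exact h

theorem sup_pair_eq_self {a b : α} {r : Setoid α} (h : r a b) : r ⊔ pair a b = r :=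
  sup_eq_left.2 (pair_le_iff.2 h)

theorem sup_pair_iff {r : Setoid α} {a b x y : α} :
    (r ⊔ pair a b) x y ↔ r x y ∨ (r x a ∧ r b y) ∨ (r x b ∧ r a y) := by
  constructor
  · intro h
    let t : Setoid α :=
      { r := fun x y => r x y ∨ (r x a ∧ r b y) ∨ (r x b ∧ r a y)
        iseqv := by
          have hs := @Setoid.symm' _ r
          have ht := @Setoid.trans' _ r
          refine ⟨fun x => Or.inl (r.refl' x), ?_, ?_⟩
          · rintro x y (h | ⟨h1, h2⟩ | ⟨h1, h2⟩)
            · exact Or.inl (hs h)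
            · exact Or.inr (Or.inr ⟨hs h2, hs h1⟩)
            · exact Or.inr (Or.inl ⟨hs h2, hs h1⟩)
          · rintro x y z (h | ⟨h1, h2⟩ | ⟨h1, h2⟩) (h' | ⟨h1', h2'⟩ | ⟨h1', h2'⟩)
            · exact Or.inl (ht h h')
            · exact Or.inr (Or.inl ⟨ht h h1', h2'⟩)
            · exact Or.inr (Or.inr ⟨ht h h1', h2'⟩)
            · exact Or.inr (Or.inl ⟨h1, ht h2 h'⟩)
            · exact Or.inr (Or.inl ⟨h1, h2'⟩)
            · exact Or.inl (ht h1 h2')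
            · exact Or.inr (Or.inr ⟨h1, ht h2 h'⟩)
            · exact Or.inl (ht h1 h2')
            · exact Or.inr (Or.inr ⟨h1, h2'⟩) }
    have hle : r ⊔ pair a b ≤ t :=
      sup_le (fun {x y} h => Or.inl h)
        (pair_le_iff.2 (Or.inr (Or.inl ⟨r.refl' a, r.refl' b⟩)))
    exact hle h
  · have hr : r ≤ r ⊔ pair a b := le_sup_left
    have hab : (r ⊔ pair a b) a b := (le_sup_right : pair a b ≤ r ⊔ pair a b) (pair_rel a b)
    rintro (h | ⟨h1, h2⟩ | ⟨h1, h2⟩)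
    · exact hr h
    · exact Setoid.trans' _ (hr h1) (Setoid.trans' _ hab (hr h2))
    · exact Setoid.trans' _ (hr h1) (Setoid.trans' _ (Setoid.symm' _ hab) (hr h2))

/-- Identifying two inequivalent elements lowers the number of classes by one. -/
theorem numClasses_sup_pair [Finite α] {r : Setoid α} {a b : α} (h : ¬ r a b) :
    (r ⊔ pair a b).numClasses + 1 = r.numClasses := by
  classical
  let f : Quotient r → Option (Quotient (r ⊔ pair a b)) := fun q =>
    if q = Quotient.mk r a then none
    else some (Setoid.map_of_le (le_sup_left : r ≤ r ⊔ pair a b) q)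
  have hf : Function.Bijective f := by
    constructor
    · intro p q
      induction p using Quotient.inductionOn with | _ x
      induction q using Quotient.inductionOn with | _ y
      have hx : ((Quotient.mk r x) = Quotient.mk r a) ↔ r x a := Quotient.eq
      have hy : ((Quotient.mk r y) = Quotient.mk r a) ↔ r y a := Quotient.eq
      by_cases h1 : r x a <;> by_cases h2 : r y a
      · intro _
        exact Quotient.sound (Setoid.trans' _ h1 (Setoid.symm' _ h2))
      · simp [f, hx, hy, h1, h2]
      · simp [f, hx, hy, h1, h2]
      · simp only [f, hx, hy, h1, h2, if_false, Option.some.injEq]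
        intro h3
        have h4 : (r ⊔ pair a b) x y := Quotient.exact h3
        rw [sup_pair_iff] at h4
        rcases h4 with h4 | ⟨h4, -⟩ | ⟨-, h4⟩
        · exact Quotient.sound h4
        · exact absurd h4 h1
        · exact absurd (Setoid.symm' _ h4) h2
    · rintro (_ | q)
      · exact ⟨Quotient.mk r a, by simp [f]⟩
      · induction q using Quotient.inductionOn with | _ x
        by_cases hx : r x a
        · refine ⟨Quotient.mk r b, ?_⟩
          have hb : ¬ Quotient.mk r b = Quotient.mk r a := fun e =>
            h (Setoid.symm' _ (Quotient.exact e))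
          simp only [f, hb, if_false, Option.some.injEq]
          exact Quotient.sound (Setoid.symm' _ (sup_pair_iff.2 (Or.inr (Or.inl
            ⟨hx, r.refl' b⟩))))
        · refine ⟨Quotient.mk r x, ?_⟩
          have hb : ¬ Quotient.mk r x = Quotient.mk r a := fun e => hx (Quotient.exact e)
          simp only [f, hb, if_false]
          rfl
  have := Nat.card_eq_of_bijective f hf
  rw [Finite.card_option] at this
  exact this.symm

theorem numClasses_le_sup_pair [Finite α] (r : Setoid α) (a b : α) :
    r.numClasses ≤ (r ⊔ pair a b).numClasses + 1 := by
  by_cases h : r a b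
  · rw [sup_pair_eq_self h]; omega
  · exact (numClasses_sup_pair h).ge

theorem numClasses_anti [Finite α] {r t : Setoid α} (h : r ≤ t) : t.numClasses ≤ r.numClasses :=
  Nat.card_le_card_of_surjective (Setoid.map_of_le h) (by
    intro q
    induction q using Quotient.inductionOn with | _ x
    exact ⟨Quotient.mk r x, rfl⟩)

/-- A pair related by `t` but not by `r` could be identified in `r` without leaving `t`, which would
push the count of `t` below that of `r`. -/
theorem eq_of_le_of_numClasses_le [Finite α] {r t : Setoid α} (h : r ≤ t)
    (hc : r.numClasses ≤ t.numClasses) : r = t := by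
  refine le_antisymm h fun {x y} hxy => ?_
  by_contra hn
  have h1 := numClasses_sup_pair hn
  have h2 : r ⊔ pair x y ≤ t := sup_le h (pair_le_iff.2 hxy)
  have h3 := numClasses_anti h2
  omega

theorem numClasses_pos [Finite α] [Nonempty α] (r : Setoid α) : 0 < r.numClasses :=
  have : Nonempty (Quotient r) := ⟨Quotient.mk r (Classical.arbitrary α)⟩
  Nat.card_pos

theorem numClasses_top [Nonempty α] : (⊤ : Setoid α).numClasses = 1 := by
  have : Subsingleton (Quotient (⊤ : Setoid α)) := Quotient.subsingleton_iff.2 rfl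
  have : Nonempty (Quotient (⊤ : Setoid α)) := ⟨Quotient.mk _ (Classical.arbitrary α)⟩
  exact Nat.card_unique

theorem numClasses_eqvGen (R : α → α → Prop) :
    (EqvGen.setoid R).numClasses = Nat.card (Quot R) := by
  refine Nat.card_congr (Quot.congrRight fun x y => ?_) |>.trans
    (Nat.card_congr (⟨?_, ?_, ?_, ?_⟩ : Quot (EqvGen R) ≃ Quot R))
  · exact Iff.rfl
  · exact Quot.lift (Quot.mk R) fun x y h => Quot.eqvGen_sound h
  · exact Quot.map id fun x y h => EqvGen.rel _ _ h
  · intro q; induction q using Quot.ind; rfl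
  · intro q; induction q using Quot.ind; rfl

end Setoid

/-! ### Cycle counts and signs of permutations -/

namespace Equiv.Perm

variable {α : Type*}

/-- The equivalence relation whose classes are the cycles (fixed points included). -/
def orbits (σ : Equiv.Perm α) : Setoid α := SameCycle.setoid σ

theorem orbits_eq_eqvGen (σ : Equiv.Perm α) :
    σ.orbits = EqvGen.setoid (fun x y => y = σ x) := by
  apply le_antisymm
  · have h : ∀ x : α, ∀ n : ℕ, EqvGen.setoid (fun x y => y = σ x) x ((σ ^ n) x) := by
      intro x n
      induction n with
      | zero => exact Setoid.refl' _ x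
      | succ n ih =>
        rw [pow_succ', mul_apply]
        exact Setoid.trans' _ ih (EqvGen.rel _ _ rfl)
    rintro x y ⟨i, rfl⟩
    obtain ⟨n, rfl | rfl⟩ := i.eq_nat_or_neg
    · exact h x n
    · have := h ((σ ^ (-(n : ℤ))) x) n
      rw [← zpow_natCast, ← mul_apply, ← zpow_add, add_neg_cancel, zpow_zero, one_apply] at this
      exact Setoid.symm' _ this
  · refine Setoid.eqvGen_le ?_
    rintro x y rfl
    exact ⟨1, by simp⟩

/-- `cycleType` omits the fixed points, which have to be counted separately as classes. -/
theorem card_cycleType_add_card_fixed [Fintype α] [DecidableEq α] (σ : Equiv.Perm α) :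
    σ.orbits.numClasses = Multiset.card σ.cycleType + (Fintype.card α - σ.support.card) := by
  classical
  let f : α → σ.cycleFactorsFinset ⊕ {x // x ∉ σ.support} := fun x =>
    if h : x ∈ σ.support then Sum.inl ⟨σ.cycleOf x, cycleOf_mem_cycleFactorsFinset_iff.2 h⟩
    else Sum.inr ⟨x, h⟩
  have key : ∀ x y, f x = f y ↔ σ.SameCycle x y := by
    intro x y
    by_cases hx : x ∈ σ.support <;> by_cases hy : y ∈ σ.support
    · simp only [f, hx, hy, dif_pos, Sum.inl.injEq, Subtype.mk.injEq]
      exact (sameCycle_iff_cycleOf_eq_of_mem_support hx hy).symm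
    · simp only [f, hx, hy, dif_pos, dif_neg, not_false_eq_true, reduceCtorEq, false_iff]
      intro h
      apply hy
      rw [mem_support] at hx ⊢
      intro h'
      exact hx (h.apply_eq_self_iff.2 h')
    · simp only [f, hx, hy, dif_pos, dif_neg, not_false_eq_true, reduceCtorEq, false_iff]
      intro h
      apply hx
      rw [mem_support] at hy ⊢
      intro h'
      exact hy (h.apply_eq_self_iff.1 h')
    · simp only [f, hx, hy, dif_neg, not_false_eq_true, Sum.inr.injEq, Subtype.mk.injEq]
      refine ⟨fun h => h ▸ SameCycle.refl _ _, fun h => ?_⟩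
      rw [notMem_support] at hx
      exact h.eq_of_left hx
  have hsurj : Function.Surjective f := by
    rintro (⟨c, hc⟩ | ⟨x, hx⟩)
    · obtain ⟨x, hx⟩ := (mem_cycleFactorsFinset_iff.1 hc).1.nonempty_support
      have h2 := cycle_is_cycleOf hx hc
      have h3 : x ∈ σ.support := mem_cycleFactorsFinset_support_le hc hx
      exact ⟨x, by simp only [f, h3, dif_pos, ← h2]⟩
    · exact ⟨x, by simp only [f, hx, dif_neg, not_false_eq_true]⟩
  have h1 : σ.orbits = Setoid.ker f := by
    ext x y
    exact (key x y).symm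
  have h2 : σ.orbits.numClasses = Nat.card (σ.cycleFactorsFinset ⊕ {x // x ∉ σ.support}) := by
    rw [h1]
    exact Nat.card_congr (Setoid.quotientKerEquivOfSurjective f hsurj)
  rw [h2, Nat.card_sum, Nat.card_eq_fintype_card, Nat.card_eq_fintype_card,
    Fintype.card_subtype_compl, Fintype.card_coe, Fintype.card_coe, cycleType_def,
    Multiset.card_map]
  rfl

/-- The sign of a permutation is determined by the parity of the number of its cycles. -/
theorem sign_eq_neg_one_pow_numClasses [Fintype α] [DecidableEq α] (σ : Equiv.Perm α) :
    sign σ = (-1) ^ (Fintype.card α + σ.orbits.numClasses) := by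
  have h1 := card_cycleType_add_card_fixed σ
  have h2 : σ.support.card ≤ Fintype.card α := Finset.card_le_univ _
  rw [sign_of_cycleType, sum_cycleType, h1]
  obtain ⟨m, hm⟩ := Nat.exists_eq_add_of_le h2
  rw [hm]
  have : σ.support.card + m + (Multiset.card σ.cycleType + (σ.support.card + m - σ.support.card))
      = σ.support.card + Multiset.card σ.cycleType + 2 * m := by omega
  rw [this, pow_add _ _ (2 * m), pow_mul]
  simp

end Equiv.Perm

/-! ### Two involutions that interchange a set with its complement -/

section TwoInvolutions

variable {α : Type*} {g j : α → α} {P : α → Prop}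

/-- The composition of two involutions that interchange `P` with its complement, on `P`. -/
def compPerm (hg : Function.Involutive g) (hj : Function.Involutive j)
    (hgP : ∀ x, P (g x) ↔ ¬ P x) (hjP : ∀ x, P (j x) ↔ ¬ P x) : Equiv.Perm {x // P x} where
  toFun x := ⟨g (j x), by simp [hgP, hjP, x.2]⟩
  invFun x := ⟨j (g x), by simp [hgP, hjP, x.2]⟩
  left_inv x := by simp [hg _, hj _]
  right_inv x := by simp [hg _, hj _]

/-- Along a class the two involutions alternate, and so do `P` and its complement. The composition
thus moves two steps at a time and visits all points of the class in `P` in a single cycle. -/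
theorem numClasses_orbits_compPerm (hg : Function.Involutive g) (hj : Function.Involutive j)
    (hgP : ∀ x, P (g x) ↔ ¬ P x) (hjP : ∀ x, P (j x) ↔ ¬ P x) :
    (compPerm hg hj hgP hjP).orbits.numClasses =
      (EqvGen.setoid fun x y => y = g x ∨ y = j x).numClasses := by
  classical
  set t := EqvGen.setoid fun x y => y = g x ∨ y = j x
  set σ := compPerm hg hj hgP hjP
  -- A retraction onto `P` that moves each point within its class.
  let ρ : α → {x // P x} := fun x =>
    if h : P x then ⟨x, h⟩ else ⟨g x, by rw [hgP]; exact h⟩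
  have hρ : ∀ x, t x (ρ x) := by
    intro x
    by_cases h : P x
    · simp only [ρ, h, dif_pos]; exact t.refl' x
    · simp only [ρ, h, dif_neg, not_false_eq_true]; exact EqvGen.rel _ _ (Or.inl rfl)
  have h1 : ∀ x y : {x // P x}, σ.orbits x y → t x y := by
    intro x y h
    have hle : σ.orbits ≤ t.comap Subtype.val := by
      rw [Equiv.Perm.orbits_eq_eqvGen]
      refine Setoid.eqvGen_le ?_
      rintro x y rfl
      exact t.trans' (EqvGen.rel _ _ (Or.inr rfl)) (EqvGen.rel _ _ (Or.inl rfl))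
    exact hle h
  have hσ : ∀ x, σ.orbits x (σ x) := fun x => ⟨1, by simp⟩
  have h2 : t ≤ σ.orbits.comap ρ := by
    refine Setoid.eqvGen_le ?_
    rintro x y (rfl | rfl)
    · have : ρ (g x) = ρ x := by
        by_cases h : P x
        · simp [ρ, h, hgP, hg x]
        · simp [ρ, h, hgP]
      show σ.orbits _ _
      rw [this]
    · show σ.orbits _ _
      by_cases h : P x
      · have : ρ (j x) = σ (ρ x) := by simp [ρ, h, hjP, σ, compPerm]
        rw [this]
        exact hσ _
      · have : ρ x = σ (ρ (j x)) := by simp [ρ, h, hjP, σ, compPerm, hj x]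
        rw [this]
        exact Setoid.symm' _ (hσ _)
  have hρ' : ∀ x : {x // P x}, ρ x = x := fun x => by simp [ρ, x.2]
  refine Nat.card_eq_of_bijective
    (Quotient.map' (s₁ := σ.orbits) (s₂ := t) Subtype.val h1) ⟨?_, ?_⟩
  · intro p q
    induction p using Quotient.inductionOn' with | _ x
    induction q using Quotient.inductionOn' with | _ y
    intro h
    have h3 : t x y := Quotient.exact h
    have h4 : σ.orbits (ρ x) (ρ y) := h2 h3
    rw [hρ', hρ'] at h4
    exact Quotient.sound h4
  · intro q
    induction q using Quotient.inductionOn' with | _ x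
    exact ⟨Quotient.mk _ (ρ x), Quotient.sound (Setoid.symm' _ (hρ x))⟩

end TwoInvolutions

/-! ### Half-edges, states and components of the state graph -/

namespace Dart

variable {n : ℕ}

theorem turn_turn (i j : ZMod 4) (d : Dart n) : (d.turn i).turn j = d.turn (i + j) := by
  simp [turn, add_assoc]

@[simp] theorem turn_fst (i : ZMod 4) (d : Dart n) : (d.turn i).1 = d.1 := rfl

@[simp] theorem turn_zero (d : Dart n) : d.turn 0 = d := by simp [turn]

theorem isOver_turn_one (d : Dart n) : (d.turn 1).IsOver ↔ ¬ d.IsOver := by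
  obtain ⟨c, i⟩ := d
  revert i
  simp only [IsOver, turn]
  decide

theorem isOver_turn_neg_one (d : Dart n) : (d.turn (-1)).IsOver ↔ ¬ d.IsOver := by
  obtain ⟨c, i⟩ := d
  revert i
  simp only [IsOver, turn]
  decide

theorem isOver_turn_two (d : Dart n) : (d.turn 2).IsOver ↔ d.IsOver := by
  obtain ⟨c, i⟩ := d
  revert i
  simp only [IsOver, turn]
  decide

end Dart

namespace LinkDiagram

variable {D : LinkDiagram}

theorem glue_involutive (D : LinkDiagram) : Function.Involutive D.glue := D.glue_glue

namespace State

theorem join_fst (s : D.State) (d : Dart D.n) : (s.join d).1 = d.1 := by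
  unfold join; split_ifs <;> rfl

theorem join_involutive (s : D.State) : Function.Involutive s.join := by
  intro d
  have h1 := Dart.isOver_turn_one d
  have h2 := Dart.isOver_turn_neg_one d
  by_cases h : s d.1 = true <;> by_cases h' : d.IsOver <;>
    simp [join, h, h', h1, h2, Dart.turn_turn]

theorem isOver_join (s : D.State) (d : Dart D.n) : (s.join d).IsOver ↔ ¬ d.IsOver := by
  unfold join
  split_ifs <;> first | exact Dart.isOver_turn_one d | exact Dart.isOver_turn_neg_one d

/-- Quarter turns in the two directions differ by a half turn, that is, by going straight ahead. -/
theorem join_not (s : D.State) (d : Dart D.n) :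
    State.join (fun c => !s c) d = (s.join d).turn 2 := by
  have h1 : (1 : ZMod 4) + 2 = -1 := by decide
  have h2 : (-1 : ZMod 4) + 2 = 1 := by decide
  by_cases h : s d.1 = true <;> by_cases h' : d.IsOver <;>
    simp [join, h, h', Dart.turn_turn, h1, h2]

/-- The equivalence relation on half-edges whose classes are the circles of the state. -/
def circ (s : D.State) : Setoid (Dart D.n) :=
  EqvGen.setoid fun x y => y = D.glue x ∨ y = s.join x

theorem circ_glue (s : D.State) (d : Dart D.n) : s.circ d (D.glue d) :=
  EqvGen.rel _ _ (Or.inl rfl)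

theorem circ_join (s : D.State) (d : Dart D.n) : s.circ d (s.join d) :=
  EqvGen.rel _ _ (Or.inr rfl)

theorem circ_le_iff {s : D.State} {r : Setoid (Dart D.n)} :
    s.circ ≤ r ↔ (∀ d, r d (D.glue d)) ∧ ∀ d, r d (s.join d) := by
  refine ⟨fun h => ⟨fun d => h (circ_glue s d), fun d => h (circ_join s d)⟩, fun h => ?_⟩
  refine Setoid.eqvGen_le ?_
  rintro x y (rfl | rfl)
  exacts [h.1 x, h.2 x]

theorem circles_eq (hn : D.n ≠ 0) (s : D.State) : s.circles = s.circ.numClasses := by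
  rw [circles, if_neg hn, circ, Setoid.numClasses_eqvGen]

/-- Every half-edge at a crossing lies on the circle of one of the two over half-edges, and the
opposite half-edge on that of the other. -/
theorem circ_over (s : D.State) (d : Dart D.n) :
    (s.circ d (d.1, 1) ∧ s.circ (d.turn 2) (d.1, 3)) ∨
      (s.circ d (d.1, 3) ∧ s.circ (d.turn 2) (d.1, 1)) := by
  obtain ⟨c, i⟩ := d
  have hr := Setoid.refl' s.circ
  have h0 := s.circ_join (c, 0)
  have h2 := s.circ_join (c, 2)
  have e : ∀ i : ZMod 4, i = 0 ∨ i = 1 ∨ i = 2 ∨ i = 3 := by decide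
  have e1 : (1 : ZMod 4) + 2 = 3 := by decide
  have e2 : (2 : ZMod 4) + 2 = 0 := by decide
  have e3 : (3 : ZMod 4) + 2 = 1 := by decide
  have e4 : (2 : ZMod 4) + 1 = 3 := by decide
  have e5 : (2 : ZMod 4) + 3 = 1 := by decide
  have e6 : (-1 : ZMod 4) = 3 := by decide
  have o0 : ¬ Dart.IsOver (c, 0) := by simp only [Dart.IsOver]; decide
  have o2 : ¬ Dart.IsOver (c, 2) := by simp only [Dart.IsOver]; decide
  by_cases h : s c = true
  · simp only [join, h, if_true, o0, o2, if_false, Dart.turn, e4, zero_add] at h0 h2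
    rcases e i with rfl | rfl | rfl | rfl
    · exact Or.inl ⟨h0, by simpa [Dart.turn] using h2⟩
    · exact Or.inl ⟨hr _, by simpa only [Dart.turn, e1] using hr _⟩
    · exact Or.inr ⟨h2, by simpa only [Dart.turn, e2] using h0⟩
    · exact Or.inr ⟨hr _, by simpa only [Dart.turn, e3] using hr _⟩
  · simp only [join, h, o0, o2, if_false, Dart.turn, e5, e6, zero_add,
      Bool.false_eq_true] at h0 h2
    rcases e i with rfl | rfl | rfl | rfl
    · exact Or.inr ⟨h0, by simpa [Dart.turn] using h2⟩
    · exact Or.inl ⟨hr _, by simpa only [Dart.turn, e1] using hr _⟩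
    · exact Or.inl ⟨h2, by simpa only [Dart.turn, e2] using h0⟩
    · exact Or.inr ⟨hr _, by simpa only [Dart.turn, e3] using hr _⟩

/-- The state obtained from `s` by changing the smoothings of the crossings in `S`. -/
def flip (s : D.State) (S : Finset (Fin D.n)) : D.State := fun c => if c ∈ S then !s c else s c

@[simp] theorem flip_empty (s : D.State) : s.flip ∅ = s := by ext c; simp [flip]

theorem flip_univ (s : D.State) : s.flip Finset.univ = fun c => !s c := by ext c; simp [flip]

theorem flip_insert (s : D.State) {S : Finset (Fin D.n)} {c : Fin D.n} (hc : c ∉ S) :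
    s.flip (insert c S) = (s.flip S).flip {c} := by
  ext d
  by_cases h : d = c
  · subst h; simp [flip, hc]
  · simp [flip, h]

theorem flip_not (s : D.State) (S : Finset (Fin D.n)) :
    State.flip (fun c => !s c) S = s.flip Sᶜ := by
  ext c
  by_cases h : c ∈ S <;> simp [flip, h]

theorem join_flip_of_notMem (s : D.State) {S : Finset (Fin D.n)} {d : Dart D.n} (h : d.1 ∉ S) :
    (s.flip S).join d = s.join d := by
  simp [join, flip, h]

/-- The equivalence relation generated by the circles of `s` and by merging the circles that meet
at the crossings in `S`: the components of the subgraph with edge set `S` of the state graph. -/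
def comp (s : D.State) (S : Finset (Fin D.n)) : Setoid (Dart D.n) :=
  s.circ ⊔ EqvGen.setoid fun x y => x.1 = y.1 ∧ x.1 ∈ S

/-- By `circ_over`, the circles at a crossing are those of its two over half-edges. Merging all that
meets at `c` therefore amounts to the single edge from `(c, 1)` to `(c, 3)`. -/
theorem comp_le_iff {s : D.State} {S : Finset (Fin D.n)} {r : Setoid (Dart D.n)} :
    s.comp S ≤ r ↔ s.circ ≤ r ∧ ∀ c ∈ S, r (c, 1) (c, 3) := by
  constructor
  · intro h
    refine ⟨le_sup_left.trans h, fun c hc => h ?_⟩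
    exact (le_sup_right : _ ≤ s.comp S) (EqvGen.rel _ _ ⟨rfl, hc⟩)
  · rintro ⟨h1, h2⟩
    refine sup_le h1 (Setoid.eqvGen_le ?_)
    rintro ⟨c, i⟩ ⟨c', j⟩ ⟨h3, h4⟩
    obtain rfl : c = c' := h3
    have h := h2 c h4
    have h' := r.symm' h
    rcases s.circ_over (c, i) with ⟨hx, -⟩ | ⟨hx, -⟩ <;>
      rcases s.circ_over (c, j) with ⟨hy, -⟩ | ⟨hy, -⟩
    · exact r.trans' (h1 hx) (r.symm' (h1 hy))
    · exact r.trans' (h1 hx) (r.trans' h (r.symm' (h1 hy)))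
    · exact r.trans' (h1 hx) (r.trans' h' (r.symm' (h1 hy)))
    · exact r.trans' (h1 hx) (r.symm' (h1 hy))

theorem circ_le_comp (s : D.State) (S : Finset (Fin D.n)) : s.circ ≤ s.comp S := le_sup_left

theorem comp_of_mem (s : D.State) {S : Finset (Fin D.n)} {c : Fin D.n} (hc : c ∈ S) :
    s.comp S (c, 1) (c, 3) := (comp_le_iff.1 le_rfl).2 c hc

theorem comp_of_fst_eq (s : D.State) {S : Finset (Fin D.n)} {x y : Dart D.n} (h : x.1 = y.1)
    (hx : x.1 ∈ S) : s.comp S x y :=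
  (le_sup_right : _ ≤ s.comp S) (EqvGen.rel _ _ ⟨h, hx⟩)

@[simp] theorem comp_empty (s : D.State) : s.comp ∅ = s.circ :=
  le_antisymm (comp_le_iff.2 ⟨le_rfl, by simp⟩) (circ_le_comp s _)

theorem comp_mono (s : D.State) {S S' : Finset (Fin D.n)} (h : S ⊆ S') : s.comp S ≤ s.comp S' :=
  comp_le_iff.2 ⟨circ_le_comp s _, fun _ hc => comp_of_mem s (h hc)⟩

theorem comp_insert (s : D.State) (S : Finset (Fin D.n)) (c : Fin D.n) :
    s.comp (insert c S) = s.comp S ⊔ Setoid.pair (c, 1) (c, 3) := by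
  apply le_antisymm
  · refine comp_le_iff.2 ⟨(circ_le_comp s _).trans le_sup_left, fun e he => ?_⟩
    rcases Finset.mem_insert.1 he with rfl | he
    · exact (le_sup_right : _ ≤ s.comp S ⊔ _) (Setoid.pair_rel _ _)
    · exact (le_sup_left : s.comp S ≤ _) (comp_of_mem s he)
  · exact sup_le (comp_mono s (Finset.subset_insert _ _))
      (Setoid.pair_le_iff.2 (comp_of_mem s (Finset.mem_insert_self _ _)))

theorem comp_singleton (s : D.State) (c : Fin D.n) :
    s.comp {c} = s.circ ⊔ Setoid.pair (c, 1) (c, 3) := by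
  simpa using comp_insert s ∅ c

theorem comp_singleton_le_iff (s : D.State) (c : Fin D.n) {S : Finset (Fin D.n)} :
    s.comp {c} ≤ s.comp S ↔ s.comp S (c, 1) (c, 3) := by
  rw [comp_le_iff]
  simp [circ_le_comp]

/-- The changed smoothings reconnect half-edges only inside crossings of `S`, where `comp S` has
merged all four. -/
theorem circ_flip_le_comp (s : D.State) (S : Finset (Fin D.n)) : (s.flip S).circ ≤ s.comp S := by
  refine circ_le_iff.2 ⟨fun d => circ_le_comp s S (circ_glue s d), fun d => ?_⟩
  by_cases h : d.1 ∈ S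
  · exact comp_of_fst_eq s (join_fst _ d).symm h
  · rw [join_flip_of_notMem s h]
    exact circ_le_comp s S (circ_join s d)

theorem flip_flip (s : D.State) (S : Finset (Fin D.n)) : (s.flip S).flip S = s := by
  ext c
  by_cases h : c ∈ S <;> simp [flip, h]

theorem comp_flip (s : D.State) (S : Finset (Fin D.n)) : (s.flip S).comp S = s.comp S := by
  apply le_antisymm
  · exact comp_le_iff.2 ⟨circ_flip_le_comp s S, fun c hc => comp_of_mem s hc⟩
  · refine comp_le_iff.2 ⟨?_, fun c hc => comp_of_mem _ hc⟩
    have := circ_flip_le_comp (s.flip S) S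
    rwa [flip_flip] at this

end State

theorem comp_univ_eq_top (s : D.State) : s.comp Finset.univ = ⊤ := by
  rw [Setoid.eq_top_iff]
  intro x y
  have h : EqvGen.setoid (fun x y : Dart D.n => y = D.glue x ∨ y = x.turn 1)
      ≤ s.comp Finset.univ := by
    refine Setoid.eqvGen_le ?_
    rintro x y (rfl | rfl)
    · exact State.circ_le_comp s _ (State.circ_glue s x)
    · exact State.comp_of_fst_eq s rfl (Finset.mem_univ _)
  exact h (D.connected x y)

theorem nonempty_dart (hn : D.n ≠ 0) : Nonempty (Dart D.n) :=
  ⟨(⟨0, Nat.pos_of_ne_zero hn⟩, 0)⟩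

/-! ### The number of circles under a change of smoothing -/

namespace State

theorem numClasses_circ_eq (s : D.State) (c : Fin D.n) [Decidable (s.circ (c, 1) (c, 3))] :
    s.circ.numClasses = (s.comp {c}).numClasses + if s.circ (c, 1) (c, 3) then 0 else 1 := by
  rw [comp_singleton]
  split_ifs with h
  · rw [Setoid.sup_pair_eq_self h, add_zero]
  · rw [Setoid.numClasses_sup_pair h]

/-- The permutation of the over half-edges that goes along the circles of the state. -/
def overPerm (halt : D.IsAlternating) (s : D.State) : Equiv.Perm {d : Dart D.n // d.IsOver} :=
  compPerm D.glue_involutive s.join_involutive (fun d => halt d) s.isOver_join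

theorem sign_overPerm (halt : D.IsAlternating) (s : D.State) :
    Equiv.Perm.sign (s.overPerm halt) =
      (-1) ^ (Fintype.card {d : Dart D.n // d.IsOver} + s.circ.numClasses) := by
  rw [Equiv.Perm.sign_eq_neg_one_pow_numClasses, overPerm, numClasses_orbits_compPerm]
  rfl

/-- The new smoothing sends `(c, 1)` where the old one sent `(c, 3)` and conversely: as `1 + 1 = 3 -
1` and `1 - 1 = 3 + 1` modulo four, this is precomposition with a transposition. Hence the number of
circles changes parity. -/
theorem overPerm_flip_singleton (halt : D.IsAlternating) (s : D.State) (c : Fin D.n) :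
    (s.flip {c}).overPerm halt =
      s.overPerm halt * Equiv.swap ⟨(c, 1), Or.inl rfl⟩ ⟨(c, 3), Or.inr rfl⟩ := by
  ext1 ⟨d, hd⟩
  rw [Equiv.Perm.mul_apply]
  obtain ⟨e, i⟩ := d
  have k1 : (1 : ZMod 4) + 1 = 2 := by decide
  have k2 : (3 : ZMod 4) + 1 = 0 := by decide
  have k3 : (3 : ZMod 4) + -1 = 2 := by decide
  have o1 : Dart.IsOver (c, 1) := Or.inl rfl
  have o3 : Dart.IsOver (c, 3) := Or.inr rfl
  by_cases he : e = c
  · subst he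
    rcases hd with hd | hd
    · obtain rfl : i = 1 := hd
      rw [Equiv.swap_apply_left]
      by_cases h : s e = true <;>
        simp [overPerm, compPerm, join, flip, h, o1, o3, Dart.turn, k1, k2, k3]
    · obtain rfl : i = 3 := hd
      rw [Equiv.swap_apply_right]
      by_cases h : s e = true <;>
        simp [overPerm, compPerm, join, flip, h, o1, o3, Dart.turn, k1, k2, k3]
  · rw [Equiv.swap_apply_of_ne_of_ne (fun h => he (congrArg (fun x => x.1.1) h))
      (fun h => he (congrArg (fun x => x.1.1) h))]
    simp [overPerm, compPerm, join, flip, he]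

theorem neg_one_pow_circ_flip_singleton (halt : D.IsAlternating) (s : D.State) (c : Fin D.n) :
    (-1 : ℤˣ) ^ (s.flip {c}).circ.numClasses = - (-1) ^ s.circ.numClasses := by
  have h := sign_overPerm halt (s.flip {c})
  rw [overPerm_flip_singleton, Equiv.Perm.sign_mul, sign_overPerm, Equiv.Perm.sign_swap
    (fun h => absurd (congrArg (fun x => x.1.2) h)
      (show ¬ (1 : ZMod 4) = 3 by decide)), pow_add, pow_add,
    mul_assoc] at h
  rw [← mul_left_cancel h, mul_neg_one]

theorem odd_circ_flip_singleton (halt : D.IsAlternating) (s : D.State) (c : Fin D.n) :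
    Odd ((s.flip {c}).circ.numClasses + s.circ.numClasses) := by
  rw [← Nat.not_even_iff_odd]
  intro h
  have h1 := neg_one_pow_circ_flip_singleton halt s c
  have h2 := h.neg_one_pow (α := ℤˣ)
  rw [pow_add, h1] at h2
  rcases neg_one_pow_eq_or ℤˣ s.circ.numClasses with h3 | h3 <;> rw [h3] at h2 <;>
    revert h2 <;> decide

/-- Merging at `c` gives the same relation for both states and costs each of them at most one class.
-/
theorem numClasses_circ_flip_le (s : D.State) (c : Fin D.n) :
    (s.flip {c}).circ.numClasses ≤ s.circ.numClasses + 1 := by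
  classical
  have h1 := numClasses_circ_eq s c
  have h2 := numClasses_circ_eq (s.flip {c}) c
  rw [comp_flip] at h2
  split_ifs at h1 h2 <;> omega

/-- A change of smoothing where two different circles meet merges them. -/
theorem numClasses_circ_flip_of_not (halt : D.IsAlternating) (s : D.State) (c : Fin D.n)
    (h : ¬ s.circ (c, 1) (c, 3)) :
    (s.flip {c}).circ.numClasses + 1 = s.circ.numClasses := by
  classical
  have h1 := numClasses_circ_eq s c
  have h2 := numClasses_circ_eq (s.flip {c}) c
  rw [comp_flip] at h2
  rw [if_neg h] at h1
  -- Comparison with the merged relation leaves two counts possible; parity rules out the unchanged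
  -- one.
  obtain ⟨m, hm⟩ := odd_circ_flip_singleton halt s c
  split_ifs at h2 <;> omega

/-! ### Euler's formula for subgraphs of the state graph -/

/-- Twice the genus of the ribbon graph with edge set `S`. -/
noncomputable def genus (s : D.State) (S : Finset (Fin D.n)) : ℤ :=
  2 * (s.comp S).numClasses + S.card - s.circ.numClasses - (s.flip S).circ.numClasses

/-- An edge inside a component adds one to `S.card` and at most one circle. An edge between two
components lowers twice the component count by two, adds one to `S.card` and removes one circle, so
the genus stays the same. -/
theorem genus_le_insert (halt : D.IsAlternating) (s : D.State) {S : Finset (Fin D.n)} {c : Fin D.n}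
    (hc : c ∉ S) : s.genus S ≤ s.genus (insert c S) := by
  unfold genus
  rw [comp_insert, flip_insert s hc, Finset.card_insert_of_notMem hc]
  by_cases h : s.comp S (c, 1) (c, 3)
  · rw [Setoid.sup_pair_eq_self h]
    have := numClasses_circ_flip_le (s.flip S) c
    push_cast
    omega
  · have h1 := Setoid.numClasses_sup_pair h
    have h2 := numClasses_circ_flip_of_not halt (s.flip S) c
      (fun h' => h (circ_flip_le_comp s S h'))
    push_cast
    omega

theorem genus_mono (halt : D.IsAlternating) (s : D.State) (S T : Finset (Fin D.n)) :
    s.genus S ≤ s.genus (S ∪ T) := by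
  induction T using Finset.induction_on with
  | empty => simp
  | insert c T hc ih =>
    rw [Finset.union_insert]
    by_cases h : c ∈ S ∪ T
    · rwa [Finset.insert_eq_self.2 h]
    · exact ih.trans (genus_le_insert halt s h)

/-- The states `s` and `¬ s` have as many circles as the diagram has faces. -/
def IsPlanar (s : D.State) : Prop :=
  s.circ.numClasses + (State.circ fun c => !s c).numClasses = D.n + 2

theorem IsPlanar.not {s : D.State} (h : s.IsPlanar) : State.IsPlanar fun c => !s c := by
  unfold IsPlanar at h ⊢
  simp only [Bool.not_not]
  rw [add_comm]
  exact h

/-- The genus is monotone in `S` and vanishes at both ends: trivially for `∅`, and by planarity and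
connectedness for the full set. So it vanishes throughout. -/
theorem euler (halt : D.IsAlternating) (hn : D.n ≠ 0) {s : D.State} (hs : s.IsPlanar)
    (S : Finset (Fin D.n)) :
    (s.circ.numClasses : ℤ) + (s.flip S).circ.numClasses =
      2 * (s.comp S).numClasses + S.card := by
  have h0 : s.genus ∅ = 0 := by simp [genus]; ring
  have h1 : s.genus Finset.univ = 0 := by
    have := nonempty_dart hn
    have h2 : (Finset.univ : Finset (Fin D.n)).card = D.n := by simp
    unfold genus
    rw [comp_univ_eq_top, Setoid.numClasses_top, flip_univ, h2]
    unfold IsPlanar at hs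
    push_cast
    omega
  have h2 := genus_mono halt s ∅ S
  have h3 := genus_mono halt s S Finset.univ
  rw [Finset.empty_union, h0] at h2
  rw [Finset.union_eq_right.2 (Finset.subset_univ S), h1] at h3
  have h4 := le_antisymm h3 h2
  unfold genus at h4
  omega

end State

end LinkDiagram

/-! ### Joins of equivalence relations with transverse classes -/

namespace Setoid

variable {α : Type*}

theorem numClasses_eq_ncard {r : Setoid α} {F : Set α} (h1 : ∀ x, ∃ y ∈ F, r x y)
    (h2 : ∀ x ∈ F, ∀ y ∈ F, r x y → x = y) : r.numClasses = F.ncard := by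
  refine (Nat.card_eq_of_bijective (fun x : F => Quotient.mk r x) ⟨?_, ?_⟩).symm
  · intro x y h
    exact Subtype.ext (h2 x x.2 y y.2 (Quotient.exact h))
  · intro q
    induction q using Quotient.inductionOn with | _ x
    obtain ⟨y, hy, hxy⟩ := h1 x
    exact ⟨⟨y, hy⟩, Quotient.sound (r.symm' hxy)⟩

/-- The join of two equivalence relations no element of which lies in nontrivial classes of
both. -/
theorem numClasses_sup_of_disjoint [Finite α] (r t : Setoid α)
    (h : ∀ x y z, r x y → t x z → x = y ∨ x = z) :
    (r ⊔ t).numClasses + Nat.card α = r.numClasses + t.numClasses := by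
  let ρ : α → α := fun x => (Quotient.mk r x).out
  let τ : α → α := fun x => (Quotient.mk t x).out
  have hρ : ∀ x, r x (ρ x) := fun x => r.symm' (Quotient.mk_out x)
  have hτ : ∀ x, t x (τ x) := fun x => t.symm' (Quotient.mk_out x)
  have hρ2 : ∀ {x y}, r x y → ρ x = ρ y := fun h => congrArg Quotient.out (Quotient.sound h)
  have hτ2 : ∀ {x y}, t x y → τ x = τ y := fun h => congrArg Quotient.out (Quotient.sound h)
  have hr : r.numClasses = {x | ρ x = x}.ncard :=
    numClasses_eq_ncard (fun x => ⟨ρ x, (hρ2 (hρ x)).symm, hρ x⟩)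
      fun x hx y hy hxy => by rw [← (hx : ρ x = x), ← (hy : ρ y = y), hρ2 hxy]
  have ht : t.numClasses = {x | τ x = x}.ncard :=
    numClasses_eq_ncard (fun x => ⟨τ x, (hτ2 (hτ x)).symm, hτ x⟩)
      fun x hx y hy hxy => by rw [← (hx : τ x = x), ← (hy : τ y = y), hτ2 hxy]
  -- By disjointness the union of `r` and `t` is already transitive, so it contains the join.
  let q : Setoid α :=
    { r := fun x y => r x y ∨ t x y
      iseqv := by
        refine ⟨fun x => Or.inl (r.refl' x), fun h => h.imp r.symm' t.symm', ?_⟩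
        rintro x y z (h1 | h1) (h2 | h2)
        · exact Or.inl (r.trans' h1 h2)
        · rcases h y x z (r.symm' h1) h2 with rfl | rfl
          · exact Or.inr h2
          · exact Or.inl h1
        · rcases h y z x h2 (t.symm' h1) with rfl | rfl
          · exact Or.inr h1
          · exact Or.inl h2
        · exact Or.inr (t.trans' h1 h2) }
  have hq : r ⊔ t ≤ q := sup_le (fun {x y} h => Or.inl h) (fun {x y} h => Or.inr h)
  have hs : (r ⊔ t).numClasses = ({x | ρ x = x} ∩ {x | τ x = x}).ncard := by
    refine numClasses_eq_ncard (fun x => ?_) fun x hx y hy hxy => ?_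
    · have hx : (r ⊔ t) x (ρ (τ x)) :=
        Setoid.trans' _ ((le_sup_right : t ≤ r ⊔ t) (hτ x)) ((le_sup_left : r ≤ r ⊔ t) (hρ _))
      refine ⟨ρ (τ x), ⟨(hρ2 (hρ _)).symm, ?_⟩, hx⟩
      rcases h _ _ _ (hρ (τ x)) (t.symm' (hτ x)) with h1 | h1
      · rw [← h1]; exact (hτ2 (hτ x)).symm
      · rw [h1]
        rcases h _ _ _ (hρ x) (hτ x) with h2 | h2
        · rw [← h2]; exact h1
        · show τ (ρ x) = ρ x
          rcases h _ _ _ (r.symm' (hρ x)) (hτ (ρ x)) with h3 | h3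
          · rw [h3]; exact h1
          · exact h3.symm
    · rcases hq hxy with h1 | h1
      · rw [← (hx.1 : ρ x = x), ← (hy.1 : ρ y = y), hρ2 h1]
      · rw [← (hx.2 : τ x = x), ← (hy.2 : τ y = y), hτ2 h1]
  -- Every element represents its class in `r` or in `t`, and those that do both represent the
  -- classes of the join; the count is then inclusion-exclusion.
  have hu : {x | ρ x = x} ∪ {x | τ x = x} = Set.univ := by
    ext x
    simp only [Set.mem_union, Set.mem_ofPred_eq, Set.mem_univ, iff_true]
    exact (h _ _ _ (hρ x) (hτ x)).imp Eq.symm Eq.symm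
  have := Set.ncard_union_add_ncard_inter {x | ρ x = x} {x | τ x = x}
  rw [hu, Set.ncard_univ] at this
  omega

end Setoid

/-! ### Adequate states and parallel crossings -/

namespace LinkDiagram

variable {D : LinkDiagram}

namespace State

/-- The state graph has no loops. -/
def IsAdequate (s : D.State) : Prop := ∀ c, ¬ s.circ (c, 1) (c, 3)

/-- Two crossings are parallel if they join the same two circles of the state. -/
def par (s : D.State) : Setoid (Fin D.n) := Setoid.ker fun c => s.comp {c}

theorem numClasses_comp_singleton {s : D.State} (hs : s.IsAdequate) (c : Fin D.n) :
    (s.comp {c}).numClasses + 1 = s.circ.numClasses := by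
  rw [comp_singleton, Setoid.numClasses_sup_pair (hs c)]

/-- Without loops each single edge lowers the number of components by exactly one, so an inclusion
of such relations is an equality. -/
theorem par_iff_comp {s : D.State} (hs : s.IsAdequate) {c c' : Fin D.n} :
    s.par c c' ↔ s.comp {c} (c', 1) (c', 3) := by
  constructor
  · intro h
    rw [show s.comp {c} = s.comp {c'} from h]
    exact comp_of_mem s (Finset.mem_singleton_self _)
  · intro h
    refine (Setoid.eq_of_le_of_numClasses_le ((comp_singleton_le_iff s c').2 h) ?_).symm
    have h1 := numClasses_comp_singleton hs c
    have h2 := numClasses_comp_singleton hs c'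
    omega

theorem par_iff_circ {s : D.State} (hs : s.IsAdequate) {c c' : Fin D.n} :
    s.par c c' ↔ (s.circ (c', 1) (c, 1) ∧ s.circ (c', 3) (c, 3)) ∨
      (s.circ (c', 1) (c, 3) ∧ s.circ (c', 3) (c, 1)) := by
  rw [par_iff_comp hs, comp_singleton, Setoid.sup_pair_iff]
  have h := hs c'
  simp only [h, false_or, Setoid.comm' s.circ (x := (c', 3))]

theorem numClasses_comp_lt {s : D.State} (hs : s.IsAdequate) {S : Finset (Fin D.n)}
    (hS : S.Nonempty) : (s.comp S).numClasses + 1 ≤ s.circ.numClasses := by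
  obtain ⟨c, hc⟩ := hS
  have h1 := numClasses_comp_singleton hs c
  have h2 := Setoid.numClasses_anti (comp_mono s (Finset.singleton_subset_iff.2 hc))
  omega

/-- Any one edge of `S` already lowers the count by one. If nothing more is lost, each edge of `S`
alone generates the same relation as `S`. -/
theorem numClasses_comp_eq_iff {s : D.State} (hs : s.IsAdequate) {S : Finset (Fin D.n)}
    (hS : S.Nonempty) :
    (s.comp S).numClasses + 1 = s.circ.numClasses ↔ ∀ c ∈ S, ∀ c' ∈ S, s.par c c' := by
  constructor
  · intro h
    have key : ∀ c ∈ S, s.comp {c} = s.comp S := fun c hc => by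
      refine Setoid.eq_of_le_of_numClasses_le
        (comp_mono s (Finset.singleton_subset_iff.2 hc)) ?_
      have h1 := numClasses_comp_singleton hs c
      omega
    exact fun c hc c' hc' => (key c hc).trans (key c' hc').symm
  · intro h
    obtain ⟨c, hc⟩ := hS
    rw [← numClasses_comp_singleton hs c]
    congr 2
    refine le_antisymm (comp_le_iff.2 ⟨circ_le_comp s _, fun c' hc' => ?_⟩)
      (comp_mono s (Finset.singleton_subset_iff.2 hc))
    exact (par_iff_comp hs).1 (h c hc c' hc')

theorem numClasses_circ_le_comp_add_card (s : D.State) (S : Finset (Fin D.n)) :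
    s.circ.numClasses ≤ (s.comp S).numClasses + S.card := by
  induction S using Finset.induction_on with
  | empty => simp
  | insert c S hc ih =>
    rw [comp_insert, Finset.card_insert_of_notMem hc]
    have := Setoid.numClasses_le_sup_pair (s.comp S) (c, 1) (c, 3)
    omega

/-- A connected graph has at most one vertex more than it has classes of parallel edges. -/
theorem numClasses_circ_le_par (hn : D.n ≠ 0) (s : D.State) :
    s.circ.numClasses ≤ s.par.numClasses + 1 := by
  classical
  -- One edge from each parallel class: these still connect the graph, and each lowers the number of
  -- components by at most one.
  let R : Finset (Fin D.n) := Finset.univ.image fun c => (Quotient.mk s.par c).out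
  have hR : R.card ≤ s.par.numClasses := by
    have h1 : R ⊆ (Finset.univ : Finset (Quotient s.par)).image Quotient.out := by
      intro x hx
      obtain ⟨c, -, rfl⟩ := Finset.mem_image.1 hx
      exact Finset.mem_image_of_mem _ (Finset.mem_univ _)
    refine (Finset.card_le_card h1).trans (Finset.card_image_le.trans ?_)
    rw [Finset.card_univ, Setoid.numClasses, Nat.card_eq_fintype_card]
  have htop : s.comp R = ⊤ := by
    rw [eq_top_iff, ← comp_univ_eq_top s]
    refine comp_le_iff.2 ⟨circ_le_comp s _, fun c _ => ?_⟩
    have h1 : s.par (Quotient.mk s.par c).out c := Quotient.mk_out c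
    rw [← comp_singleton_le_iff, ← (show s.comp _ = s.comp {c} from h1)]
    exact comp_mono s (Finset.singleton_subset_iff.2
      (Finset.mem_image_of_mem _ (Finset.mem_univ c)))
  have h := numClasses_circ_le_comp_add_card s R
  have := nonempty_dart hn
  rw [htop, Setoid.numClasses_top] at h
  omega

/-! ### Crossings that are parallel for both extreme states -/

/-- Two edges that are parallel in the dual graph form a cut. -/
theorem not_comp_compl_pair (halt : D.IsAlternating) (hn : D.n ≠ 0) {s : D.State}
    (hs : s.IsPlanar) (ht : State.IsAdequate fun c => !s c) {c c' : Fin D.n} (hc : c ≠ c')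
    (h : State.par (fun c => !s c) c c') : ¬ s.comp {c, c'}ᶜ (c, 1) (c, 3) := by
  intro h'
  -- Flipping a set from the dual state is flipping its complement from `s`. The four formulas give
  -- two components for the complement of `{c, c'}` but only one for that of `{c'}`, whereas `h'`
  -- would make these relations equal.
  have e1 := euler halt hn hs.not {c, c'}
  have e2 := euler halt hn hs.not {c'}
  have e3 := euler halt hn hs {c, c'}ᶜ
  have e4 := euler halt hn hs {c'}ᶜ
  have k1 := (numClasses_comp_eq_iff ht (S := {c, c'}) (by simp)).2 (by
    have h2 := Setoid.symm' _ h
    have h3 := Setoid.refl' (State.par fun c => !s c)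
    intro x hx y hy
    simp only [Finset.mem_insert, Finset.mem_singleton] at hx hy
    rcases hx with rfl | rfl <;> rcases hy with rfl | rfl
    exacts [h3 _, h, h2, h3 _])
  have k2 := numClasses_comp_singleton ht c'
  have k3 : s.comp {c'}ᶜ = s.comp {c, c'}ᶜ := by
    have : ({c'}ᶜ : Finset (Fin D.n)) = insert c {c, c'}ᶜ := by
      ext x
      by_cases hx : x = c
      · subst hx; simp [hc]
      · simp [hx]
    rw [this, comp_insert, Setoid.sup_pair_eq_self h']
  have c1 : ({c, c'} : Finset (Fin D.n)).card = 2 := Finset.card_pair hc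
  have c2 : (({c, c'}ᶜ : Finset (Fin D.n)).card : ℤ) = D.n - 2 := by
    have := Finset.card_add_card_compl ({c, c'} : Finset (Fin D.n))
    rw [c1, Fintype.card_fin] at this
    omega
  have c3 : (({c'}ᶜ : Finset (Fin D.n)).card : ℤ) = D.n - 1 := by
    have := Finset.card_add_card_compl ({c'} : Finset (Fin D.n))
    rw [Finset.card_singleton, Fintype.card_fin] at this
    omega
  rw [flip_not] at e1 e2
  rw [c1] at e1
  rw [Finset.card_singleton] at e2
  rw [c2] at e3
  rw [c3, k3] at e4
  unfold IsPlanar at hs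
  push_cast at e1 e2
  omega

/-- Both edges of the cut run between the same two circles, which lie on different sides. Going
straight ahead changes sides at `c` and `c'`, while any other crossing lies within one component. -/
theorem comp_compl_turn_two {s : D.State} (hs : s.IsAdequate) {c c' : Fin D.n}
    (h : s.par c c') (hcut : ¬ s.comp {c, c'}ᶜ (c, 1) (c, 3)) (d : Dart D.n) :
    s.comp {c, c'}ᶜ (c, 1) (d.turn 2) ↔
      if d.1 = c ∨ d.1 = c' then ¬ s.comp {c, c'}ᶜ (c, 1) d else s.comp {c, c'}ᶜ (c, 1) d := by
  set r := s.comp {c, c'}ᶜ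
  have hr : ∀ {x y}, s.circ x y → r x y := fun h => circ_le_comp s _ h
  have hsymm := @Setoid.symm' _ r
  have htrans := @Setoid.trans' _ r
  split_ifs with hd
  · have key : (r d (c, 1) ∧ r (d.turn 2) (c, 3)) ∨ (r d (c, 3) ∧ r (d.turn 2) (c, 1)) := by
      rcases hd with hd | hd
      · rw [← hd]
        exact (s.circ_over d).imp (And.imp hr hr) (And.imp hr hr)
      · have h1 := s.circ_over d
        rw [hd] at h1
        rcases (par_iff_circ hs).1 h with ⟨h2, h3⟩ | ⟨h2, h3⟩ <;>
          rcases h1 with ⟨h4, h5⟩ | ⟨h4, h5⟩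
        · exact Or.inl ⟨htrans (hr h4) (hr h2), htrans (hr h5) (hr h3)⟩
        · exact Or.inr ⟨htrans (hr h4) (hr h3), htrans (hr h5) (hr h2)⟩
        · exact Or.inr ⟨htrans (hr h4) (hr h2), htrans (hr h5) (hr h3)⟩
        · exact Or.inl ⟨htrans (hr h4) (hr h3), htrans (hr h5) (hr h2)⟩
    rcases key with ⟨h1, h2⟩ | ⟨h1, h2⟩
    · exact iff_of_false (fun h3 => hcut (htrans h3 h2)) (not_not.2 (hsymm h1))
    · exact iff_of_true (hsymm h2) (fun h3 => hcut (htrans h3 h1))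
  · have h1 : r d (d.turn 2) := comp_of_fst_eq s rfl (by simpa using hd)
    exact ⟨fun h2 => htrans h2 (hsymm h1), fun h2 => htrans h2 h1⟩

/-- In a knot diagram no crossing is parallel to other crossings for both extreme states. -/
theorem eq_or_eq_of_par (hknot : D.IsKnot) (halt : D.IsAlternating) {s : D.State}
    (hs : s.IsPlanar) (h1 : s.IsAdequate) (h2 : State.IsAdequate fun c => !s c)
    (c c' c'' : Fin D.n) (h3 : s.par c c') (h4 : State.par (fun c => !s c) c c'') :
    c = c' ∨ c = c'' := by
  by_contra! hne
  obtain ⟨hc', hc''⟩ := hne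
  have hn : D.n ≠ 0 := fun h => (finCongr h c).elim0
  have hA := not_comp_compl_pair halt hn hs h2 hc'' h4
  -- Otherwise the edge `c'`, parallel to `c` for `s`, survives the removal of `c` and `c''` and
  -- still joins the ends of `c`.
  obtain rfl : c' = c'' := by
    by_contra hne
    refine hA ?_
    rw [← comp_singleton_le_iff, show s.comp {c} = s.comp {c'} from h3]
    exact comp_mono s (by simp [hne, hc'.symm])
  have hss : (fun c => !!s c) = s := funext fun c => Bool.not_not _
  have hB := not_comp_compl_pair halt hn hs.not (by simpa only [hss] using h1) hc'
    (show State.par (fun c => !!s c) c c' by rw [hss]; exact h3)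
  set t : D.State := fun c => !s c
  have hA2 := comp_compl_turn_two h1 h3 hA
  have hB2 := comp_compl_turn_two h2 h4 hB
  -- Whether a half-edge lies on the same side, relative to `(c, 1)`, of both cuts. Going straight
  -- ahead changes both sides or neither, so `Q` is constant along the knot.
  let Q : Dart D.n → Prop := fun d =>
    s.comp {c, c'}ᶜ (c, 1) d ↔ t.comp {c, c'}ᶜ (c, 1) d
  have hinv : EqvGen.setoid (fun x y => y = D.glue x ∨ y = x.turn 2) ≤ Setoid.ker Q := by
    refine Setoid.eqvGen_le ?_
    rintro x y (rfl | rfl) <;> refine propext ?_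
    · have e : ∀ u : D.State, u.comp {c, c'}ᶜ (c, 1) x ↔ u.comp {c, c'}ᶜ (c, 1) (D.glue x) :=
        fun u => by
          have h := circ_le_comp u {c, c'}ᶜ (circ_glue u x)
          exact ⟨fun h' => Setoid.trans' _ h' h, fun h' => Setoid.trans' _ h' (Setoid.symm' _ h)⟩
      simp only [Q, ← e]
    · simp only [Q, hA2 x, hB2 x]
      split_ifs
      · exact not_iff_not.symm
      · rfl
  have hQ : Q (c, 1) = Q (s.join (c, 1)) := hinv (hknot _ _)
  have hq1 : Q (c, 1) := iff_of_true (Setoid.refl' _ _) (Setoid.refl' _ _)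
  have hq2 : Q (s.join (c, 1)) := hQ ▸ hq1
  -- The smoothing of `s` stays on the side of `(c, 1)` in the cut for `s`, hence by `Q` also in the
  -- cut for `t`. But the opposite half-edge is `t.join (c, 1)`, on that same side of the second
  -- cut, although going straight ahead must change sides.
  have h5 := hq2.1 (circ_le_comp s _ (circ_join s _))
  have h6 : t.comp {c, c'}ᶜ (c, 1) (t.join (c, 1)) := circ_le_comp t _ (circ_join t _)
  rw [show t.join (c, 1) = (s.join (c, 1)).turn 2 from join_not s _, hB2,
    if_pos (Or.inl (join_fst s _))] at h6
  exact h6 h5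

end State

/-! ### Faces and the extreme states -/

variable (D) in
/-- The state with the same smoothing at all crossings. -/
def constState (b : Bool) : D.State := fun _ => b

/-- This is the checkerboard colouring: all corners of a face have the same type. -/
theorem isOver_nextCorner (halt : D.IsAlternating) (d : Dart D.n) :
    (D.nextCorner d).IsOver ↔ d.IsOver := by
  rw [nextCorner, Dart.isOver_turn_neg_one, halt d, not_not]

theorem nextCorner_eq (halt : D.IsAlternating) {b : Bool} {d : Dart D.n}
    (h : d.IsOver ↔ b = false) : D.nextCorner d = (D.constState b).join (D.glue d) := by
  have h1 := halt d
  rw [h] at h1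
  cases b <;> simp [State.join, constState, h1, nextCorner]

/-- The corner next to the half-edge `d` through which the circle of `d` passes in the state
`constState b`. -/
def nearCorner (b : Bool) (d : Dart D.n) : Dart D.n :=
  if d.IsOver ↔ b = false then d else (D.constState b).join d

theorem isOver_nearCorner (b : Bool) (d : Dart D.n) :
    (nearCorner b d).IsOver ↔ b = false := by
  unfold nearCorner
  split_ifs with h
  · exact h
  · rw [State.isOver_join]; tauto

theorem nearCorner_fst (b : Bool) (d : Dart D.n) : (nearCorner b d).1 = d.1 := by
  unfold nearCorner
  split_ifs
  · rfl
  · exact State.join_fst _ _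

theorem nearCorner_of_isOver {b : Bool} {d : Dart D.n} (h : d.IsOver ↔ b = false) :
    nearCorner b d = d := if_pos h

theorem nearCorner_turn_two (b : Bool) (d : Dart D.n) :
    nearCorner b (d.turn 2) = (nearCorner b d).turn 2 := by
  unfold nearCorner
  simp only [Dart.isOver_turn_two]
  split_ifs
  · rfl
  · simp only [State.join, Dart.turn_fst, Dart.isOver_turn_two]
    split_ifs <;> simp [Dart.turn_turn, add_comm]

theorem circ_nearCorner (b : Bool) (d : Dart D.n) :
    (D.constState b).circ d (nearCorner b d) := by
  unfold nearCorner
  split_ifs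
  · exact Setoid.refl' _ _
  · exact State.circ_join _ _

/-- On corners of the colour of `b`, the walk around a face is `glue` followed by the smoothing, so
it follows a circle of `constState b`. -/
theorem face_nearCorner_eq (halt : D.IsAlternating) {b : Bool} {x y : Dart D.n}
    (h : (D.constState b).circ x y) : D.face (nearCorner b x) = D.face (nearCorner b y) := by
  have hle : (D.constState b).circ ≤ Setoid.ker fun x => D.face (nearCorner b x) := by
    have hnext : ∀ d, D.face d = D.face (D.nextCorner d) := fun d => Quot.sound rfl
    have hglue : ∀ d : Dart D.n, (d.IsOver ↔ b = false) →
        D.face (nearCorner b d) = D.face (nearCorner b (D.glue d)) := by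
      intro d hd
      have : nearCorner b (D.glue d) = D.nextCorner d := by
        rw [nextCorner_eq halt hd]
        refine if_neg ?_
        rw [halt d, hd]; tauto
      rw [this, nearCorner_of_isOver hd, hnext]
    refine State.circ_le_iff.2 ⟨fun d => ?_, fun d => ?_⟩
    · by_cases hd : d.IsOver ↔ b = false
      · exact hglue d hd
      · have h1 := hglue (D.glue d) (by rw [halt d]; tauto)
        rw [D.glue_glue] at h1
        exact h1.symm
    · show D.face _ = D.face _
      congr 1
      unfold nearCorner
      have hj := State.isOver_join (D.constState b) d
      by_cases hd : d.IsOver ↔ b = false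
      · rw [if_pos hd, if_neg (by tauto), State.join_involutive]
      · rw [if_neg hd, if_pos (by rw [hj]; tauto)]
  exact hle h

theorem face_eq (halt : D.IsAlternating) {x y : Dart D.n} (h : D.face x = D.face y) {b : Bool}
    (hx : x.IsOver ↔ b = false) :
    (y.IsOver ↔ b = false) ∧ (D.constState b).circ x y := by
  let r : Setoid (Dart D.n) :=
    (Setoid.ker fun d : Dart D.n => (d.IsOver ↔ b = false)) ⊓
      -- The value `none` on the other colour lets the circle be compared along all faces at once.
      (Setoid.ker fun d : Dart D.n => if d.IsOver ↔ b = false then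
        some (Quotient.mk (D.constState b).circ d) else none)
  have h1 : EqvGen.setoid (fun x y : Dart D.n => y = D.nextCorner x) ≤ r := by
    refine Setoid.eqvGen_le ?_
    rintro x y rfl
    have h2 := isOver_nextCorner halt x
    refine ⟨by simp only [Setoid.ker_def, h2], ?_⟩
    simp only [Setoid.ker_def, h2]
    split_ifs with h3
    · rw [nextCorner_eq halt h3]
      exact congrArg some (Quotient.sound (Setoid.trans' _ (State.circ_glue _ x)
        (State.circ_join _ _)))
    · rfl
  obtain ⟨h2, h3⟩ := h1 (Quot.eqvGen_exact h)
  have hy : y.IsOver ↔ b = false := Eq.mp h2 hx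
  refine ⟨hy, ?_⟩
  have h4 := Setoid.ker_def.1 h3
  simp only [hx, hy, if_true, Option.some.injEq] at h4
  exact Quotient.exact h4

/-- The boundaries of the faces are the circles of the two extreme states. -/
theorem card_face (halt : D.IsAlternating) :
    Nat.card D.Face =
      (D.constState true).circ.numClasses + (D.constState false).circ.numClasses := by
  have hb : ∀ d : Dart D.n, d.IsOver ↔ (!decide d.IsOver) = false := by simp
  let f : D.Face → (Σ b : Bool, Quotient (D.constState b).circ) :=
    Quot.lift (fun d => ⟨!decide d.IsOver, Quotient.mk _ d⟩) (by
      rintro x y rfl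
      have h : (!decide (D.nextCorner x).IsOver) = !decide x.IsOver := by
        simp [isOver_nextCorner halt x]
      have h2 := (face_eq halt (y := D.nextCorner x) (Quot.sound rfl) (hb x)).2
      rw [h]
      exact congrArg _ (Quotient.sound h2))
  have hf : Function.Bijective f := by
    constructor
    · intro p q
      induction p using Quot.ind with | _ x
      induction q using Quot.ind with | _ y
      intro h
      have h1 : (!decide x.IsOver) = !decide y.IsOver := congrArg Sigma.fst h
      have h3 := hb y
      have h2 : HEq (Quotient.mk (D.constState (!decide x.IsOver)).circ x)
        (Quotient.mk (D.constState (!decide y.IsOver)).circ y) := (Sigma.mk.inj h).2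
      rw [← h1] at h2 h3
      have h4 := face_nearCorner_eq halt (Quotient.exact (eq_of_heq h2))
      rwa [nearCorner_of_isOver (hb x), nearCorner_of_isOver h3] at h4
    · rintro ⟨b, q⟩
      induction q using Quotient.inductionOn with | _ x
      refine ⟨D.face (nearCorner b x), ?_⟩
      have h1 : (!decide (nearCorner b x).IsOver) = b := by
        simp only [isOver_nearCorner]; cases b <;> simp
      show (⟨_, Quotient.mk (D.constState (!decide (nearCorner b x).IsOver)).circ _⟩ :
        Σ b : Bool, Quotient (D.constState b).circ) = _
      rw [h1]
      exact congrArg _ (Quotient.sound (Setoid.symm' _ (circ_nearCorner b x)))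
  rw [Nat.card_eq_of_bijective f hf, Nat.card_sigma]
  simp [Setoid.numClasses]

theorem isPlanar_constState (halt : D.IsAlternating) (hn : D.n ≠ 0) (b : Bool) :
    (D.constState b).IsPlanar := by
  have h := D.planar (Nat.pos_of_ne_zero hn)
  have h1 : (D.constState true).IsPlanar := by
    have h2 := card_face halt
    exact h2.symm.trans h
  cases b
  · exact h1.not
  · exact h1

/-- A loop at `c` would place two opposite corners of `c` in one face. -/
theorem isAdequate_constState (halt : D.IsAlternating) (hred : D.IsReduced) (b : Bool) :
    (D.constState b).IsAdequate := by
  intro c h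
  have h1 := face_nearCorner_eq halt h
  have h2 : ((c, 3) : Dart D.n) = Dart.turn 2 (c, 1) :=
    Prod.ext rfl (show (3 : ZMod 4) = 1 + 2 by decide)
  rw [h2, nearCorner_turn_two] at h1
  exact hred _ h1

/-- Opposite corners have the same colour, and faces of one colour correspond to the circles of one
extreme state. Sharing two opposite faces is thus joining the same two circles. -/
theorem twistRelated_iff (halt : D.IsAlternating) (hred : D.IsReduced) {c c' : Fin D.n} :
    D.TwistRelated c c' ↔ (D.constState true).par c c' ∨ (D.constState false).par c c' := by
  have had := isAdequate_constState halt hred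
  constructor
  · rintro ⟨i, j, h1, h2⟩
    suffices h : ∃ b, (D.constState b).par c c' by
      obtain ⟨b, hb⟩ := h
      cases b
      exacts [Or.inr hb, Or.inl hb]
    refine ⟨!decide (Dart.IsOver (c, i)), ?_⟩
    set b := !decide (Dart.IsOver (c, i)) with hb
    have hi : Dart.IsOver (c, i) ↔ b = false := by simp [hb]
    have hi2 : Dart.IsOver (c, i + 2) ↔ b = false :=
      (Dart.isOver_turn_two (c, i)).trans hi
    have h3 := (face_eq halt h1 hi).2
    have h4 := (face_eq halt h2 hi2).2
    rw [State.par_iff_comp (had b)]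
    have hle := State.circ_le_comp (D.constState b) {c}
    have h5 : (D.constState b).comp {c} (c', j) (c', j + 2) :=
      Setoid.trans' _ (Setoid.symm' _ (hle h3)) (Setoid.trans' _
        (State.comp_of_fst_eq _ (x := (c, i)) (y := (c, i + 2)) rfl
          (Finset.mem_singleton_self c)) (hle h4))
    rcases (D.constState b).circ_over (c', j) with ⟨h6, h7⟩ | ⟨h6, h7⟩
    · exact Setoid.trans' _ (Setoid.symm' _ (hle h6)) (Setoid.trans' _ h5 (hle h7))
    · exact Setoid.symm' _
        (Setoid.trans' _ (Setoid.symm' _ (hle h6)) (Setoid.trans' _ h5 (hle h7)))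
  · suffices h : ∀ b, (D.constState b).par c c' → D.TwistRelated c c' from
      fun h' => h'.elim (h true) (h false)
    intro b h
    have key : ∀ d d' : Dart D.n, d.1 = c → d'.1 = c' → D.face d = D.face d' →
        D.face (d.turn 2) = D.face (d'.turn 2) → D.TwistRelated c c' := by
      rintro ⟨c, i⟩ ⟨c', j⟩ rfl rfl h1 h2
      exact ⟨i, j, h1, h2⟩
    have t1 : ∀ e : Fin D.n, ((e, 3) : Dart D.n) = Dart.turn 2 (e, 1) :=
      fun e => Prod.ext rfl (show (3 : ZMod 4) = 1 + 2 by decide)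
    have t3 : ∀ e : Fin D.n, ((e, 1) : Dart D.n) = Dart.turn 2 (e, 3) :=
      fun e => Prod.ext rfl (show (1 : ZMod 4) = 3 + 2 by decide)
    rcases (State.par_iff_circ (had b)).1 h with ⟨h1, h2⟩ | ⟨h1, h2⟩
    · refine key (nearCorner b (c, 1)) (nearCorner b (c', 1)) (nearCorner_fst _ _)
        (nearCorner_fst _ _) (face_nearCorner_eq halt h1).symm ?_
      rw [← nearCorner_turn_two, ← nearCorner_turn_two, ← t1, ← t1]
      exact (face_nearCorner_eq halt h2).symm
    · refine key (nearCorner b (c, 3)) (nearCorner b (c', 1)) (nearCorner_fst _ _)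
        (nearCorner_fst _ _) (face_nearCorner_eq halt h1).symm ?_
      rw [← nearCorner_turn_two, ← nearCorner_turn_two, ← t1, ← t3]
      exact (face_nearCorner_eq halt h2).symm

theorem twistNumber_add (hknot : D.IsKnot) (halt : D.IsAlternating) (hred : D.IsReduced)
    (hn : D.n ≠ 0) :
    D.twistNumber + D.n =
      (D.constState true).par.numClasses + (D.constState false).par.numClasses := by
  have had := isAdequate_constState halt hred
  have h1 : EqvGen.setoid D.TwistRelated = (D.constState true).par ⊔ (D.constState false).par := by
    rw [Setoid.sup_eq_eqvGen]
    congr 1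
    ext c c'
    exact twistRelated_iff halt hred
  have h2 := Setoid.numClasses_sup_of_disjoint _ _
    (State.eq_or_eq_of_par hknot halt (isPlanar_constState halt hn true) (had true) (had false))
  rw [Nat.card_fin] at h2
  rw [twistNumber, ← Setoid.numClasses_eqvGen, h1]
  exact h2

/-! ### Bigons -/

/-- The two shared faces are those across the two edges of the bigon; at each crossing they occupy
the two corners adjacent to the bigon's corner. -/
theorem twistRelated_of_bigonRelated {c c' : Fin D.n} (h : D.BigonRelated c c') :
    D.TwistRelated c c' := by
  obtain ⟨d, -, h2, rfl, rfl⟩ := h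
  have key : ∀ d, D.face ((D.nextCorner d).turn 1) = D.face (d.turn (-1)) := by
    intro d
    refine Quot.sound ?_
    simp [nextCorner, Dart.turn_turn, D.glue_glue]
  have h3 := key (D.nextCorner d)
  rw [h2] at h3
  refine ⟨d.2 + -1, (D.nextCorner d).2 + 1, ?_, ?_⟩
  · exact (key d).symm
  · have e : ∀ i : ZMod 4, i + -1 + 2 = i + 1 ∧ i + 1 + 2 = i + -1 := by decide
    rw [(e _).1, (e _).2]
    exact h3

theorem twistNumber_eq_bigonTwistNumber (h : D.IsTwistReduced) :
    D.twistNumber = D.bigonTwistNumber := by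
  rw [twistNumber, bigonTwistNumber, ← Setoid.numClasses_eqvGen, ← Setoid.numClasses_eqvGen]
  congr 1
  refine le_antisymm (Setoid.eqvGen_le fun c c' h' => h c c' h') ?_
  exact Setoid.eqvGen_mono fun c c' h' => twistRelated_of_bigonRelated h'

end LinkDiagram

/-- The alternating sum over the nonempty sets of pairwise equivalent elements. -/
theorem Setoid.sum_neg_one_pow_card {α : Type*} [Fintype α] (r : Setoid α)
    [DecidablePred fun S : Finset α => S.Nonempty ∧ ∀ x ∈ S, ∀ y ∈ S, r x y] :
    (∑ S : Finset α, if S.Nonempty ∧ ∀ x ∈ S, ∀ y ∈ S, r x y then (-1 : ℤ) ^ S.card else 0) =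
      -(r.numClasses : ℤ) := by
  classical
  -- A nonempty set of pairwise equivalent elements lies in exactly one class. The full alternating
  -- sum over the subsets of a class is zero, so dropping the empty set leaves `-1`.
  let fib : Quotient r → Finset α := fun q => Finset.univ.filter fun x => Quotient.mk r x = q
  have h1 : ∀ S : Finset α,
      (if S.Nonempty ∧ ∀ x ∈ S, ∀ y ∈ S, r x y then (-1 : ℤ) ^ S.card else 0) =
        ∑ q, if S.Nonempty ∧ S ⊆ fib q then (-1 : ℤ) ^ S.card else 0 := by
    intro S
    by_cases hS : S.Nonempty
    · obtain ⟨c, hc⟩ := id hS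
      rw [Finset.sum_eq_single (Quotient.mk r c)]
      · refine if_congr (and_congr_right fun _ => ⟨fun h x hx => ?_, fun h x hx y hy => ?_⟩) rfl rfl
        · simpa [fib] using Quotient.sound (h x hx c hc)
        · have hx' := h hx
          have hy' := h hy
          simp only [fib, Finset.mem_filter, Finset.mem_univ, true_and] at hx' hy'
          exact Quotient.exact (hx'.trans hy'.symm)
      · intro q _ hq
        refine if_neg fun h => hq ?_
        have := h.2 hc
        simp only [fib, Finset.mem_filter, Finset.mem_univ, true_and] at this
        exact this.symm
      · simp
    · simp [hS]
  simp only [h1]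
  rw [Finset.sum_comm]
  have h2 : ∀ q, (∑ S : Finset α, if S.Nonempty ∧ S ⊆ fib q then (-1 : ℤ) ^ S.card else 0) = -1 := by
    intro q
    have hne : (fib q).Nonempty := by
      induction q using Quotient.inductionOn with | _ x
      exact ⟨x, by simp [fib]⟩
    have h3 := Finset.sum_powerset_neg_one_pow_card_of_nonempty hne
    rw [← Finset.sum_filter]
    have h4 : (Finset.univ.filter fun S : Finset α => S.Nonempty ∧ S ⊆ fib q) =
        (fib q).powerset.erase ∅ := by
      ext S
      simp [Finset.nonempty_iff_ne_empty]
    rw [h4, ← add_left_inj ((-1 : ℤ) ^ (∅ : Finset α).card),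
      Finset.sum_erase_add _ _ (Finset.empty_mem_powerset _), h3]
    simp
  rw [Finset.sum_congr rfl fun q _ => h2 q]
  simp [Setoid.numClasses]

/-! ### Extreme coefficients of the state sum -/

namespace LinkDiagram

open LaurentPolynomial

theorem coeff_T_mul (n : ℤ) (f : LaurentPolynomial ℤ) (j : ℤ) :
    (T n * f).coeff j = f.coeff (j - n) := by
  rw [T, AddMonoidAlgebra.coeff_single_mul_apply, one_mul, neg_add_eq_sub]

theorem coeff_one_eq (j : ℤ) : (1 : LaurentPolynomial ℤ).coeff j = if 0 = j then 1 else 0 := by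
  rw [← T_zero, T_apply]

theorem coeff_circleValue_mul (f : LaurentPolynomial ℤ) (j : ℤ) :
    (circleValue * f).coeff j = - f.coeff (j - 2) - f.coeff (j + 2) := by
  have : circleValue * f = - (T 2 * f) - T (-2) * f := by rw [circleValue]; ring
  rw [this, AddMonoidAlgebra.coeff_sub, AddMonoidAlgebra.coeff_neg, Finsupp.sub_apply,
    Finsupp.neg_apply, coeff_T_mul, coeff_T_mul, sub_neg_eq_add]

theorem coeff_circleValue_pow_neg (m : ℕ) (j : ℤ) :
    (circleValue ^ m).coeff (-j) = (circleValue ^ m).coeff j := by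
  induction m generalizing j with
  | zero => simp only [pow_zero, coeff_one_eq, zero_eq_neg, @eq_comm ℤ 0 j]
  | succ m ih =>
    rw [pow_succ', coeff_circleValue_mul, coeff_circleValue_mul, ← ih (j - 2), ← ih (j + 2)]
    rw [show -(j - 2) = -j + 2 by ring, show -(j + 2) = -j - 2 by ring]
    ring

theorem coeff_circleValue_pow_of_lt (m : ℕ) {j : ℤ} (h : 2 * m < j) :
    (circleValue ^ m).coeff j = 0 := by
  induction m generalizing j with
  | zero =>
    have : j ≠ 0 := by simp at h; omega
    rw [pow_zero, coeff_one_eq, if_neg this.symm]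
  | succ m ih =>
    push_cast at h
    rw [pow_succ', coeff_circleValue_mul, ih (by omega), ih (by omega)]
    ring

theorem coeff_circleValue_pow_top (m : ℕ) :
    (circleValue ^ m).coeff (2 * m : ℤ) = (-1) ^ m := by
  induction m with
  | zero => rw [pow_zero, coeff_one_eq]; rfl
  | succ m ih =>
    rw [pow_succ', coeff_circleValue_mul,
      coeff_circleValue_pow_of_lt m (j := 2 * ((m + 1 : ℕ) : ℤ) + 2) (by push_cast; omega)]
    push_cast
    rw [show 2 * ((m : ℤ) + 1) - 2 = 2 * m by ring, ih]
    ring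

/-- The second term of the binomial expansion. It is also valid for `m = 0`, where both sides
vanish. -/
theorem coeff_circleValue_pow_sub_four (m : ℕ) :
    (circleValue ^ m).coeff (2 * m - 4 : ℤ) = (-1) ^ m * m := by
  induction m with
  | zero => rw [pow_zero, coeff_one_eq]; rfl
  | succ m ih =>
    rw [pow_succ', coeff_circleValue_mul]
    push_cast
    rw [show 2 * ((m : ℤ) + 1) - 4 - 2 = 2 * m - 4 by ring,
      show 2 * ((m : ℤ) + 1) - 4 + 2 = 2 * m by ring, ih, coeff_circleValue_pow_top]
    ring

variable {D : LinkDiagram}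

theorem coeff_kauffmanBracket (j : ℤ) :
    D.kauffmanBracket.coeff j = ∑ s : D.State, (circleValue ^ s.circles).coeff (j - s.sigma) := by
  rw [kauffmanBracket, AddMonoidAlgebra.coeff_sum, Finsupp.finsetSum_apply]
  exact Finset.sum_congr rfl fun s _ => coeff_T_mul _ _ _

namespace State

theorem flip_bijective (s : D.State) : Function.Bijective s.flip := by
  constructor
  · intro S S' h
    ext c
    have := congrFun h c
    simp only [flip] at this
    by_cases h1 : c ∈ S <;> by_cases h2 : c ∈ S' <;> simp_all
  · intro s'
    refine ⟨Finset.univ.filter fun c => s' c ≠ s c, ?_⟩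
    ext c
    by_cases h : s' c = s c <;> simp [flip, h]
    exact (Bool.eq_not.2 (Ne.symm h))

theorem sigma_flip_const (b : Bool) (S : Finset (Fin D.n)) :
    ((D.constState b).flip S).sigma = (if b = true then 1 else -1) * (D.n - 2 * S.card) := by
  have h : ∀ c, (if (D.constState b).flip S c = true then (1 : ℤ) else -1) =
      (if b = true then 1 else -1) * (1 - 2 * if c ∈ S then 1 else 0) := by
    intro c
    by_cases h : c ∈ S <;> cases b <;> simp [flip, constState, h]
  rw [sigma, Finset.sum_congr rfl fun c _ => h c, ← Finset.mul_sum, Finset.sum_sub_distrib,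
    ← Finset.mul_sum]
  simp

/-- The coefficients of the state sum, with exponents counted from the side of the state `s`. -/
noncomputable def sideCoeff (s : D.State) (j : ℤ) : ℤ :=
  ∑ S : Finset (Fin D.n),
    (circleValue ^ (s.flip S).circ.numClasses).coeff (j - (D.n - 2 * S.card))

/-- Powers of the circle value are invariant under `A ↦ A⁻¹`, so both ends of the bracket are
treated alike. -/
theorem coeff_kauffmanBracket_eq_sideCoeff (hn : D.n ≠ 0) (b : Bool) (j : ℤ) :
    D.kauffmanBracket.coeff ((if b = true then 1 else -1) * j) = (D.constState b).sideCoeff j := by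
  rw [coeff_kauffmanBracket, ← (flip_bijective (D.constState b)).sum_comp, sideCoeff]
  refine Finset.sum_congr rfl fun S _ => ?_
  rw [sigma_flip_const, circles_eq hn, ← mul_sub]
  cases b
  · simp only [Bool.false_eq_true, if_false, neg_one_mul, coeff_circleValue_pow_neg]
  · simp

section Side

variable {s : D.State} (halt : D.IsAlternating) (hn : D.n ≠ 0) (hs : s.IsPlanar)
  (had : s.IsAdequate)

include halt hn hs had

/-- Euler's formula with `k(S) ≤ |s| - 1`. It puts the top exponent of the term of `S` at least four
below that of `s`. -/
theorem numClasses_flip_le {S : Finset (Fin D.n)} (hS : S.Nonempty) :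
    (s.flip S).circ.numClasses + 2 ≤ s.circ.numClasses + S.card := by
  have h1 := euler halt hn hs S
  have h2 := numClasses_comp_lt had hS
  omega

theorem numClasses_flip_eq_iff {S : Finset (Fin D.n)} (hS : S.Nonempty) :
    (s.flip S).circ.numClasses + 2 = s.circ.numClasses + S.card ↔
      ∀ c ∈ S, ∀ c' ∈ S, s.par c c' := by
  rw [← numClasses_comp_eq_iff had hS]
  have h1 := euler halt hn hs S
  omega

theorem sideCoeff_of_lt {j : ℤ} (hj : D.n + 2 * s.circ.numClasses < j) : s.sideCoeff j = 0 := by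
  refine Finset.sum_eq_zero fun S _ => coeff_circleValue_pow_of_lt _ ?_
  rcases S.eq_empty_or_nonempty with rfl | hS
  · rw [flip_empty, Finset.card_empty]
    push_cast
    omega
  · have := numClasses_flip_le halt hn hs had hS
    omega

theorem sideCoeff_top :
    s.sideCoeff (D.n + 2 * s.circ.numClasses) = (-1) ^ s.circ.numClasses := by
  rw [sideCoeff, Finset.sum_eq_single ∅]
  · rw [flip_empty, Finset.card_empty, ← coeff_circleValue_pow_top]
    congr 1
    push_cast
    ring
  · intro S _ hS
    have := numClasses_flip_le halt hn hs had (Finset.nonempty_iff_ne_empty.2 hS)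
    exact coeff_circleValue_pow_of_lt _ (by omega)
  · simp

/-- The empty set contributes its second coefficient, and the sets of parallel edges their leading
ones, `-1` per class up to the common sign. -/
theorem sideCoeff_sub_four :
    s.sideCoeff (D.n + 2 * s.circ.numClasses - 4) =
      (-1) ^ s.circ.numClasses * (s.circ.numClasses - s.par.numClasses) := by
  classical
  have key : ∀ S : Finset (Fin D.n), (circleValue ^ (s.flip S).circ.numClasses).coeff
      (D.n + 2 * s.circ.numClasses - 4 - (D.n - 2 * S.card) : ℤ) =
      (if S = ∅ then (-1) ^ s.circ.numClasses * (s.circ.numClasses : ℤ) else 0) +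
        (-1) ^ s.circ.numClasses *
          if S.Nonempty ∧ ∀ x ∈ S, ∀ y ∈ S, s.par x y then (-1 : ℤ) ^ S.card else 0 := by
    intro S
    rcases S.eq_empty_or_nonempty with rfl | hS
    · rw [flip_empty, Finset.card_empty]
      simp only [Finset.not_nonempty_empty, false_and, if_false, if_true, mul_zero, add_zero]
      rw [← coeff_circleValue_pow_sub_four]
      congr 1
      push_cast
      ring
    · have h1 := numClasses_flip_le halt hn hs had hS
      have h2 := numClasses_flip_eq_iff halt hn hs had hS
      rw [if_neg hS.ne_empty, zero_add]
      by_cases h3 : ∀ c ∈ S, ∀ c' ∈ S, s.par c c'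
      · have h4 := h2.2 h3
        rw [if_pos ⟨hS, h3⟩, ← pow_add, ← h4, pow_add, show (-1 : ℤ) ^ 2 = 1 by norm_num, mul_one,
          ← coeff_circleValue_pow_top]
        congr 1
        omega
      · rw [if_neg fun h => h3 h.2, mul_zero]
        rw [← h2] at h3
        exact coeff_circleValue_pow_of_lt _ (by omega)
  rw [sideCoeff, Finset.sum_congr rfl fun S _ => key S, Finset.sum_add_distrib, ← Finset.mul_sum,
    Setoid.sum_neg_one_pow_card]
  simp
  ring

/-- The sign of the difference is known because the state graph is connected
(`numClasses_circ_le_par`). -/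
theorem abs_sideCoeff_sub :
    |s.sideCoeff (D.n + 2 * s.circ.numClasses - 4) - s.sideCoeff (D.n + 2 * s.circ.numClasses)| =
      s.par.numClasses + 1 - s.circ.numClasses := by
  rw [sideCoeff_sub_four halt hn hs had, sideCoeff_top halt hn hs had, ← mul_sub_one, abs_mul,
    abs_neg_one_pow, one_mul]
  have := numClasses_circ_le_par hn s
  rw [abs_of_nonpos (by omega)]
  ring

end Side

end State

theorem bracket_coefficients (hknot : D.IsKnot) (halt : D.IsAlternating) (hred : D.IsReduced) :
    ∃ k l : ℤ,
      IsGreatest {j : ℤ | D.kauffmanBracket.coeff j ≠ 0} k ∧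
      IsLeast {j : ℤ | D.kauffmanBracket.coeff j ≠ 0} l ∧
      |D.kauffmanBracket.coeff (k - 4) - D.kauffmanBracket.coeff k| +
        |D.kauffmanBracket.coeff (l + 4) - D.kauffmanBracket.coeff l| = (D.twistNumber : ℤ) := by
  by_cases hn : D.n = 0
  -- The bracket of the crossingless circle has equal coefficients at `2` and `-2`, which are four
  -- apart, so both differences vanish.
  · have : IsEmpty (Fin D.n) := by rw [hn]; infer_instance
    have hb : ∀ j, D.kauffmanBracket.coeff j =
        (if (2 : ℤ) = j then -1 else 0) + if (-2 : ℤ) = j then -1 else 0 := by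
      intro j
      rw [coeff_kauffmanBracket, Fintype.sum_unique, State.circles, if_pos hn, State.sigma,
        Finset.univ_eq_empty, Finset.sum_empty, pow_one, sub_zero, circleValue,
        AddMonoidAlgebra.coeff_sub, AddMonoidAlgebra.coeff_neg, Finsupp.sub_apply,
        Finsupp.neg_apply, T_apply, T_apply]
      split_ifs <;> simp
    have hsupp : ∀ j, D.kauffmanBracket.coeff j ≠ 0 ↔ j = 2 ∨ j = -2 := by
      intro j
      rw [hb]
      split_ifs <;> omega
    have hT : D.twistNumber = 0 := by
      have : IsEmpty (Quot D.TwistRelated) := ⟨fun q => isEmptyElim q.out⟩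
      exact Nat.card_of_isEmpty
    refine ⟨2, -2, ⟨(hsupp 2).2 (Or.inl rfl), fun j hj => ?_⟩,
      ⟨(hsupp _).2 (Or.inr rfl), fun j hj => ?_⟩, ?_⟩
    · have := (hsupp j).1 hj; omega
    · have := (hsupp j).1 hj; omega
    · rw [hT]
      simp only [hb]
      norm_num
  · have hp := isPlanar_constState halt hn
    have ha := isAdequate_constState halt hred
    have ht : ∀ j, D.kauffmanBracket.coeff j = (D.constState true).sideCoeff j := fun j => by
      simpa using State.coeff_kauffmanBracket_eq_sideCoeff hn true j
    have hf : ∀ j, D.kauffmanBracket.coeff j = (D.constState false).sideCoeff (-j) := fun j => by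
      simpa using State.coeff_kauffmanBracket_eq_sideCoeff hn false (-j)
    refine ⟨D.n + 2 * (D.constState true).circ.numClasses,
      -(D.n + 2 * (D.constState false).circ.numClasses), ⟨?_, ?_⟩, ⟨?_, ?_⟩, ?_⟩
    · show D.kauffmanBracket.coeff _ ≠ 0
      rw [ht, State.sideCoeff_top halt hn (hp _) (ha _)]
      exact pow_ne_zero _ (by norm_num)
    · intro j hj
      by_contra! h
      exact hj (by rw [ht, State.sideCoeff_of_lt halt hn (hp _) (ha _) h])
    · show D.kauffmanBracket.coeff _ ≠ 0
      rw [hf, neg_neg, State.sideCoeff_top halt hn (hp _) (ha _)]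
      exact pow_ne_zero _ (by norm_num)
    · intro j hj
      by_contra! h
      exact hj (by rw [hf, State.sideCoeff_of_lt halt hn (hp _) (ha _) (by omega)])
    · rw [ht, ht, hf, hf, neg_neg, neg_add, neg_neg, ← sub_eq_add_neg,
        State.abs_sideCoeff_sub halt hn (hp _) (ha _),
        State.abs_sideCoeff_sub halt hn (hp _) (ha _)]
      have h1 := twistNumber_add hknot halt hred hn
      have h2 : (D.constState true).circ.numClasses + (D.constState false).circ.numClasses =
        D.n + 2 := hp true
      omega

end LinkDiagram

namespace LinkDiagram

open LaurentPolynomial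

variable {D : LinkDiagram}

/-! ### The exponents of the bracket modulo four -/

namespace Orientation

variable (o : D.Orientation)

/-- The state all of whose smoothings respect the orientation. -/
def seifert : D.State := fun c => decide (o.out (c, 1) = o.out (c, 2))

theorem sigma_seifert : o.seifert.sigma = o.writhe := by
  simp [State.sigma, writhe, sign, seifert]

theorem out_join_seifert (d : Dart D.n) : o.out (o.seifert.join d) = !o.out d := by
  obtain ⟨c, i⟩ := d
  have h3 : o.out (c, 3) = !o.out (c, 1) := o.out_turn (c, 1)
  have h0 : o.out (c, 0) = !o.out (c, 2) := o.out_turn (c, 2)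
  have e : ∀ i : ZMod 4, i = 0 ∨ i = 1 ∨ i = 2 ∨ i = 3 := by decide
  have o0 : ¬ Dart.IsOver (c, 0) := by simp only [Dart.IsOver]; decide
  have o2 : ¬ Dart.IsOver (c, 2) := by simp only [Dart.IsOver]; decide
  have o1 : Dart.IsOver (c, 1) := Or.inl rfl
  have o3 : Dart.IsOver (c, 3) := Or.inr rfl
  have e1 : (1 : ZMod 4) + 1 = 2 := by decide
  have e2 : (3 : ZMod 4) + 1 = 0 := by decide
  have e3 : (3 : ZMod 4) + -1 = 2 := by decide
  have e4 : (2 : ZMod 4) + 1 = 3 := by decide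
  have e5 : (2 : ZMod 4) + -1 = 1 := by decide
  have e6 : (0 : ZMod 4) + -1 = 3 := by decide
  by_cases h : o.out (c, 1) = o.out (c, 2) <;> rcases e i with rfl | rfl | rfl | rfl <;>
    simp only [State.join, seifert, h, o0, o1, o2, o3, Dart.turn, e1, e2, e3, e4, e5, e6, h3, h0,
      decide_true, decide_false, if_true, if_false, zero_add, add_neg_cancel, Bool.not_not,
      Bool.false_eq_true] <;>
    (revert h; cases o.out (c, 1) <;> cases o.out (c, 2) <;> simp)

theorem card_out : Fintype.card {d : Dart D.n // o.out d = true} = 2 * D.n := by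
  have h1 : Fintype.card {d : Dart D.n // o.out d = true} =
      Fintype.card {d : Dart D.n // ¬ o.out d = true} :=
    Fintype.card_congr (D.glue_involutive.toPerm.subtypeEquiv fun d => by
      simp [o.out_glue])
  have h2 := Fintype.card_subtype_compl fun d : Dart D.n => o.out d = true
  have h3 := Fintype.card_subtype_le fun d : Dart D.n => o.out d = true
  have h4 : Fintype.card (Dart D.n) = D.n * 4 := by
    rw [Fintype.card_prod, Fintype.card_fin, ZMod.card]
  omega

theorem turn_two_involutive {n : ℕ} : Function.Involutive (Dart.turn 2 : Dart n → Dart n) := by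
  intro d
  rw [Dart.turn_turn, show (2 : ZMod 4) + 2 = 0 by decide, Dart.turn_zero]

/-- A half turn and a smoothing together generate all quarter turns, so the classes are the
crossings. -/
theorem numClasses_turn_two_join (s : D.State) :
    (EqvGen.setoid fun x y : Dart D.n => y = x.turn 2 ∨ y = s.join x).numClasses = D.n := by
  set r := EqvGen.setoid fun x y : Dart D.n => y = x.turn 2 ∨ y = s.join x
  have h1 : ∀ x, r x (x.turn 1) := by
    intro x
    have h2 : r x (s.join x) := EqvGen.rel _ _ (Or.inr rfl)
    have h3 : r x ((s.join x).turn 2) := r.trans' h2 (EqvGen.rel _ _ (Or.inl rfl))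
    have e : (-1 : ZMod 4) + 2 = 1 := by decide
    unfold State.join at h2 h3
    split_ifs at h2 h3
    · rwa [Dart.turn_turn, e] at h3
    · exact h2
    · exact h2
    · rwa [Dart.turn_turn, e] at h3
  have h2 : ∀ k : ZMod 4, ∀ x, r x (x.turn k) := by
    intro k x
    have hk : ∀ m : ℕ, r x (x.turn (m : ZMod 4)) := by
      intro m
      induction m with
      | zero => simp
      | succ m ih =>
        have := r.trans' ih (h1 _)
        rwa [Dart.turn_turn, ← Nat.cast_succ] at this
    have := hk k.val
    rwa [ZMod.natCast_zmod_val] at this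
  have h3 : r = Setoid.ker Prod.fst := by
    apply le_antisymm
    · refine Setoid.eqvGen_le ?_
      rintro x y (rfl | rfl)
      · rfl
      · exact (State.join_fst s x).symm
    · rintro ⟨c, i⟩ ⟨c', j⟩ h
      obtain rfl : c = c' := h
      simpa [Dart.turn] using h2 (j - i) (c, i)
  rw [h3, Setoid.numClasses, Nat.card_congr (Setoid.quotientKerEquivOfSurjective _
    fun c => ⟨((c, 0) : Dart D.n), rfl⟩), Nat.card_fin]

/-- Seifert's algorithm produces as many circles as crossings plus one, modulo two. -/
theorem odd_numClasses_seifert (hknot : D.IsKnot) (hn : D.n ≠ 0) :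
    Odd (o.seifert.circ.numClasses + D.n) := by
  have hg : ∀ d, o.out (D.glue d) = true ↔ ¬ o.out d = true := fun d => by simp [o.out_glue]
  have ht : ∀ d : Dart D.n, o.out (d.turn 2) = true ↔ ¬ o.out d = true :=
    fun d => by simp [o.out_turn]
  have hj : ∀ d, o.out (o.seifert.join d) = true ↔ ¬ o.out d = true :=
    fun d => by simp [o.out_join_seifert]
  -- On outgoing half-edges, `κ` runs along the knot in one cycle, `π` along the Seifert circles,
  -- and `τ` acts within the crossings, with one cycle at each. Signs in `π = κ * τ` give the
  -- parity.
  let κ := compPerm (P := fun d => o.out d = true) D.glue_involutive turn_two_involutive hg ht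
  let π := compPerm (P := fun d => o.out d = true) D.glue_involutive o.seifert.join_involutive hg hj
  let τ := compPerm (P := fun d => o.out d = true) turn_two_involutive o.seifert.join_involutive ht hj
  have h1 : π = κ * τ := by
    ext1 x
    refine Subtype.ext ?_
    simp [κ, π, τ, compPerm, turn_two_involutive _]
  have := nonempty_dart hn
  have hκ : κ.orbits.numClasses = 1 := by
    rw [numClasses_orbits_compPerm]
    have h : (EqvGen.setoid fun x y : Dart D.n => y = D.glue x ∨ y = x.turn 2) = ⊤ :=
      Setoid.eq_top_iff.2 fun x y => hknot x y
    rw [h, Setoid.numClasses_top]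
  have hτ : τ.orbits.numClasses = D.n := by
    rw [numClasses_orbits_compPerm, numClasses_turn_two_join]
  have hπ : π.orbits.numClasses = o.seifert.circ.numClasses := by
    rw [numClasses_orbits_compPerm]
    rfl
  have h2 := congrArg Equiv.Perm.sign h1
  rw [Equiv.Perm.sign_mul, Equiv.Perm.sign_eq_neg_one_pow_numClasses,
    Equiv.Perm.sign_eq_neg_one_pow_numClasses, Equiv.Perm.sign_eq_neg_one_pow_numClasses,
    hκ, hτ, hπ, o.card_out] at h2
  simp only [pow_add, pow_mul, neg_one_sq, one_pow, one_mul, pow_one] at h2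
  rw [← Nat.not_even_iff_odd]
  intro h3
  have h4 := h3.neg_one_pow (α := ℤˣ)
  rw [pow_add, h2, mul_assoc, ← pow_add, ← two_mul, pow_mul, neg_one_sq, one_pow] at h4
  exact absurd h4 (by decide)

theorem writhe_sub_n_even : Even (o.writhe - D.n) := by
  have : o.writhe - D.n = ∑ c : Fin D.n, (o.sign c - 1) := by
    rw [Finset.sum_sub_distrib]
    simp [writhe]
  rw [this]
  refine Finset.even_sum _ fun c _ => ?_
  unfold sign
  split_ifs <;> decide

end Orientation

theorem State.circles_pos (s : D.State) : 0 < s.circles := by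
  by_cases hn : D.n = 0
  · rw [circles, if_pos hn]; exact one_pos
  · have := nonempty_dart hn
    rw [circles_eq hn]
    exact Setoid.numClasses_pos _

theorem State.four_dvd_sigma_flip_singleton (s : D.State) (c : Fin D.n) :
    (4 : ℤ) ∣ (s.flip {c}).sigma - s.sigma + 2 := by
  have h : (s.flip {c}).sigma - s.sigma = if s c = true then -2 else 2 := by
    rw [sigma, sigma, ← Finset.sum_sub_distrib, Finset.sum_eq_single c]
    · by_cases h : s c = true <;> simp [flip, h]
    · intro x _ hx
      simp [flip, hx]
    · simp
  rw [h]
  split_ifs <;> decide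

/-- All exponents of the normalized bracket are divisible by four. -/
theorem four_dvd_exponent (hknot : D.IsKnot) (halt : D.IsAlternating) (o : D.Orientation)
    (s : D.State) : (4 : ℤ) ∣ 3 * o.writhe - s.sigma + 2 * (s.circles - 1 : ℕ) := by
  by_cases hn : D.n = 0
  · have : IsEmpty (Fin D.n) := by rw [hn]; infer_instance
    rw [State.circles, if_pos hn]
    simp [State.sigma, Orientation.writhe]
  · have hpos := s.circles_pos
    suffices h : ∀ S, (4 : ℤ) ∣ 3 * o.writhe - (o.seifert.flip S).sigma +
        -- At the Seifert state `σ` is the writhe, and parity suffices. Each further flip changes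
        -- both `σ` and twice the number of circles by two modulo four.
        2 * (o.seifert.flip S).circ.numClasses - 2 by
      obtain ⟨S, rfl⟩ := (State.flip_bijective o.seifert).2 s
      have h1 := h S
      rw [← State.circles_eq hn] at h1
      omega
    intro S
    induction S using Finset.induction_on with
    | empty =>
      rw [State.flip_empty, o.sigma_seifert]
      obtain ⟨a, ha⟩ := o.odd_numClasses_seifert hknot hn
      obtain ⟨b, hb⟩ := o.writhe_sub_n_even
      omega
    | insert c S hc ih =>
      rw [State.flip_insert _ hc]
      obtain ⟨a, ha⟩ := State.odd_circ_flip_singleton halt (o.seifert.flip S) c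
      have hb := State.four_dvd_sigma_flip_singleton (o.seifert.flip S) c
      omega

/-! ### The Jones polynomial -/

theorem mapDomain_mul_T (a : ℤ) (k : ℤ) (m : ℕ) :
    AddMonoidAlgebra.mapDomain (fun m : ℤ => -4 * m)
      (C a * T k * (-(T (-1) + 1)) ^ m : LaurentPolynomial ℤ) =
      C a * T (-4 * k) * (-(T 4 + 1)) ^ m := by
  have h1 : ∀ x, AddMonoidAlgebra.mapDomain (fun m : ℤ => -4 * m) x =
    AddMonoidAlgebra.mapDomainRingHom ℤ (AddMonoidHom.mulLeft (-4 : ℤ)) x := fun x => rfl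
  have h2 : ∀ k, AddMonoidAlgebra.mapDomainRingHom ℤ (AddMonoidHom.mulLeft (-4 : ℤ)) (T k) =
      T (-4 * k) := fun k => by
    rw [← h1, T, AddMonoidAlgebra.mapDomain_single]
    rfl
  have h3 : AddMonoidAlgebra.mapDomainRingHom ℤ (AddMonoidHom.mulLeft (-4 : ℤ)) (C a) = C a := by
    rw [← h1, ← single_eq_C, AddMonoidAlgebra.mapDomain_single]
    rfl
  rw [h1, map_mul, map_mul, map_pow, map_neg, map_add, map_one, h2, h2, h3]
  norm_num

theorem exists_isJonesPolynomial (hknot : D.IsKnot) (halt : D.IsAlternating)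
    (o : D.Orientation) : ∃ V : LaurentPolynomial ℤ, IsJonesPolynomial o V := by
  set ε : ℤ := (((-1 : ℤˣ) ^ o.writhe : ℤˣ) : ℤ) with hε
  -- One circle of each state cancels against the left-hand factor. The others are written as `A⁻²
  -- (-(A⁴ + 1))`, and `t = A⁻⁴` turns the remaining power of `A` into an integral power of `t` by
  -- `four_dvd_exponent`.
  refine ⟨∑ s : D.State, C ε * T ((3 * o.writhe - s.sigma + 2 * (s.circles - 1 : ℕ)) / 4) *
    (-(T (-1) + 1)) ^ (s.circles - 1), ?_⟩
  have hcv : circleValue = T (-2) * (-(T 4 + 1)) := by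
    rw [circleValue, mul_neg, mul_add, ← T_add, mul_one]
    norm_num
    ring
  unfold IsJonesPolynomial
  rw [← hε]
  have hmap : ∀ f : D.State → LaurentPolynomial ℤ,
      AddMonoidAlgebra.mapDomain (fun m : ℤ => -4 * m) (∑ s, f s) =
        ∑ s, AddMonoidAlgebra.mapDomain (fun m : ℤ => -4 * m) (f s) := fun f =>
    map_sum (AddMonoidAlgebra.mapDomainRingHom ℤ (AddMonoidHom.mulLeft (-4 : ℤ))) f _
  rw [hmap, Finset.mul_sum, kauffmanBracket, Finset.mul_sum]
  refine Finset.sum_congr rfl fun s _ => ?_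
  rw [mapDomain_mul_T]
  obtain ⟨m, hm⟩ := Nat.exists_eq_add_of_lt s.circles_pos
  have h4 := four_dvd_exponent hknot halt o s
  rw [zero_add] at hm
  rw [hm, Nat.add_sub_cancel] at h4 ⊢
  rw [show -4 * ((3 * o.writhe - s.sigma + 2 * (m : ℤ)) / 4) =
    -3 * o.writhe + s.sigma + m * (-2) by omega, T_add, T_add, ← T_pow, pow_succ]
  have hp : circleValue ^ m = T (-2) ^ m * (-(T 4 + 1)) ^ m := by rw [hcv, mul_pow]
  rw [hp]
  ring

theorem coeff_mapDomain_neg_four_mul (V : LaurentPolynomial ℤ) (m : ℤ) :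
    (AddMonoidAlgebra.mapDomain (fun m : ℤ => -4 * m) V).coeff (-4 * m) = V.coeff m :=
  Finsupp.mapDomain_apply (f := fun m : ℤ => -4 * m) (fun a b h => by simpa using h) V.coeff m

theorem coeff_mapDomain_eq_zero (V : LaurentPolynomial ℤ) (i : ℤ)
    (h : ∀ m, i = -4 * m → V.coeff m = 0) :
    (AddMonoidAlgebra.mapDomain (fun m : ℤ => -4 * m) V).coeff i = 0 := by
  by_cases hi : i ∈ Set.range fun m : ℤ => -4 * m
  · obtain ⟨m, rfl⟩ := hi
    exact (coeff_mapDomain_neg_four_mul V m).trans (h m rfl)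
  · exact Finsupp.mapDomain_of_notMem_range V.coeff i hi

/-- The outer coefficients of the Jones polynomial in terms of those of the bracket. -/
theorem jones_coefficients {o : D.Orientation} {V : LaurentPolynomial ℤ}
    (hV : IsJonesPolynomial o V) {k l : ℤ}
    (hk : IsGreatest {j : ℤ | D.kauffmanBracket.coeff j ≠ 0} k)
    (hl : IsLeast {j : ℤ | D.kauffmanBracket.coeff j ≠ 0} l) :
    ∃ p q : ℤ, IsLeast {j : ℤ | V.coeff j ≠ 0} p ∧ IsGreatest {j : ℤ | V.coeff j ≠ 0} q ∧
      |V.coeff (p + 1)| = |D.kauffmanBracket.coeff (k - 4) - D.kauffmanBracket.coeff k| ∧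
      |V.coeff (q - 1)| = |D.kauffmanBracket.coeff (l + 4) - D.kauffmanBracket.coeff l| := by
  set B := D.kauffmanBracket
  set w := o.writhe
  set W := AddMonoidAlgebra.mapDomain (fun m : ℤ => -4 * m) V
  obtain ⟨ε, hε, hrel⟩ : ∃ ε : ℤ, |ε| = 1 ∧
      ∀ j, - W.coeff (j - 2) - W.coeff (j + 2) = ε * B.coeff (j + 3 * w) := by
    refine ⟨(((-1 : ℤˣ) ^ w : ℤˣ) : ℤ), Int.isUnit_iff_abs_eq.1 (Units.isUnit _), fun j => ?_⟩
    have := congrArg (fun f => f.coeff j) hV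
    simp only [coeff_circleValue_mul] at this
    rw [mul_assoc, ← single_eq_C, AddMonoidAlgebra.coeff_single_mul_apply, coeff_T_mul] at this
    rw [this]
    congr 2
    ring
  have hε0 : ε ≠ 0 := by rintro rfl; simp at hε
  have hW : ∀ m, W.coeff (-4 * m) = V.coeff m := coeff_mapDomain_neg_four_mul V
  have hV0 : V ≠ 0 := by
    intro h
    have h1 : W = 0 := by simp [W, h]
    have h2 := hrel (k - 3 * w)
    rw [h1, sub_add_cancel] at h2
    have h3 : B.coeff k ≠ 0 := hk.1
    simp [hε0, h3] at h2
  have hne : V.coeff.support.Nonempty :=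
    Finsupp.support_nonempty_iff.2 fun h => hV0 (AddMonoidAlgebra.coeff_eq_zero.1 h)
  obtain ⟨p, hp⟩ : ∃ p, IsLeast {j : ℤ | V.coeff j ≠ 0} p :=
    ⟨_, Finsupp.mem_support_iff.1 (Finset.min'_mem _ hne),
      fun j hj => Finset.min'_le _ _ (Finsupp.mem_support_iff.2 hj)⟩
  obtain ⟨q, hq⟩ : ∃ q, IsGreatest {j : ℤ | V.coeff j ≠ 0} q :=
    ⟨_, Finsupp.mem_support_iff.1 (Finset.max'_mem _ hne),
      fun j hj => Finset.le_max' _ _ (Finsupp.mem_support_iff.2 hj)⟩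
  have hp1 : V.coeff p ≠ 0 := hp.1
  have hq1 : V.coeff q ≠ 0 := hq.1
  have hpW : ∀ i, -4 * p < i → W.coeff i = 0 := fun i hi =>
    coeff_mapDomain_eq_zero V i fun m hm => by
      by_contra h
      have := hp.2 h
      omega
  have hqW : ∀ i, i < -4 * q → W.coeff i = 0 := fun i hi =>
    coeff_mapDomain_eq_zero V i fun m hm => by
      by_contra h
      have := hq.2 h
      omega
  -- The substitution reverses the order of exponents: the lowest term of `V` gives the highest of
  -- the bracket.
  have hk' : k = -4 * p + 2 + 3 * w := by
    refine hk.unique ⟨?_, fun j hj => ?_⟩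
    · intro h
      have := hrel (-4 * p + 2)
      rw [h, add_sub_cancel_right, hW, hpW _ (by omega)] at this
      simp [hp1] at this
    · by_contra! h
      have := hrel (j - 3 * w)
      rw [sub_add_cancel, hpW _ (by omega), hpW _ (by omega)] at this
      have h3 : B.coeff j ≠ 0 := hj
      simp [hε0, h3] at this
  have hl' : l = -4 * q - 2 + 3 * w := by
    refine hl.unique ⟨?_, fun j hj => ?_⟩
    · intro h
      have := hrel (-4 * q - 2)
      rw [h, sub_add_cancel, hW, hqW _ (by omega)] at this
      simp [hq1] at this
    · by_contra! h
      have := hrel (j - 3 * w)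
      rw [sub_add_cancel, hqW _ (by omega), hqW _ (by omega)] at this
      have h3 : B.coeff j ≠ 0 := hj
      simp [hε0, h3] at this
  have habs : ∀ x y z : ℤ, x = -(ε * (y - z)) → |x| = |y - z| := by
    rintro x y z rfl
    rw [abs_neg, abs_mul, hε, one_mul]
  refine ⟨p, q, hp, hq, habs _ _ _ ?_, habs _ _ _ ?_⟩
  -- Up to a common sign, the coefficient at `k` is that of `V` at `p`, and the one at `k - 4` is
  -- the sum of those at `p` and `p + 1`; the difference isolates the latter.
  · have h1 := hrel (-4 * p + 2)
    have h2 := hrel (-4 * p - 2)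
    rw [add_sub_cancel_right, hpW (-4 * p + 2 + 2) (by omega), ← hk'] at h1
    rw [sub_add_cancel, show -4 * p - 2 - 2 = -4 * (p + 1) by ring, hW,
      show -4 * p - 2 + 3 * w = k - 4 by omega] at h2
    linear_combination h1 - h2
  · have h1 := hrel (-4 * q - 2)
    have h2 := hrel (-4 * q + 2)
    rw [sub_add_cancel, hqW (-4 * q - 2 - 2) (by omega), hW, ← hl'] at h1
    rw [add_sub_cancel_right, show -4 * q + 2 + 2 = -4 * (q - 1) by ring, hW, hW,
      show -4 * q + 2 + 3 * w = l + 4 by omega] at h2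
    linear_combination h1 - h2

end LinkDiagram

theorem mainTheorem2 (D : LinkDiagram) (hknot : D.IsKnot) (halt : D.IsAlternating)
    (hred : D.IsReduced) :
    (∃ k l : ℤ,
      IsGreatest {j : ℤ | D.kauffmanBracket.coeff j ≠ 0} k ∧
      IsLeast {j : ℤ | D.kauffmanBracket.coeff j ≠ 0} l ∧
      |D.kauffmanBracket.coeff (k - 4) - D.kauffmanBracket.coeff k| +
        |D.kauffmanBracket.coeff (l + 4) - D.kauffmanBracket.coeff l| = (D.twistNumber : ℤ)) ∧
    (∀ o : D.Orientation, ∃ V : LaurentPolynomial ℤ, LinkDiagram.IsJonesPolynomial o V ∧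
      ∃ p q : ℤ,
        IsLeast {j : ℤ | V.coeff j ≠ 0} p ∧
        IsGreatest {j : ℤ | V.coeff j ≠ 0} q ∧
        |V.coeff (p + 1)| + |V.coeff (q - 1)| = (D.twistNumber : ℤ)) ∧
    (D.IsTwistReduced → D.twistNumber = D.bigonTwistNumber) := by
  have hbracket := LinkDiagram.bracket_coefficients hknot halt hred
  refine ⟨hbracket, fun o => ?_, LinkDiagram.twistNumber_eq_bigonTwistNumber⟩
  obtain ⟨k, l, hk, hl, h⟩ := hbracket
  obtain ⟨V, hV⟩ := LinkDiagram.exists_isJonesPolynomial hknot halt o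
  obtain ⟨p, q, hp, hq, h1, h2⟩ := LinkDiagram.jones_coefficients hV hk hl
  exact ⟨V, hV, p, q, hp, hq, by rw [h1, h2, h]⟩
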